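/- Let $\mathbb{T}=\mathbb{R}/\mathbb{Z}$, let $\mathbb{T}^2$ carry its normalised Haar measure $dx$, and for $f\in L^1(\mathbb{T}^2)$ and $(m,n)\in\mathbb{Z}^2$ put $\widehat f(m,n)=\int_{\mathbb{T}^2} f(x_1,x_2)\,e^{-2\pi i(mx_1+nx_2)}\,dx$. For $0<p<\infty$ let $H^p(\mathbb{T}^2)$ be the space of functions $f$ on $\mathbb{T}^2$ that are boundary values of a holomorphic function $F$ on the bidisk $\mathbb{D}^2=\{(z_1,z_2)\in\mathbb{C}^2:|z_1|<1,\ |z_2|<1\}$ with $$\sup_{0\le r_1,r_2<1}\int_{\mathbb{T}^2}\big|F(r_1e^{2\pi i x_1},r_2e^{2\pi i x_2})\big|^p\,dx<\infty,$$ where boundary value means that $f(x)=\lim_{r\to1^-}F(re^{2\pi i x_1},re^{2\pi i x_2})$ for almost every $x\in\mathbb{T}^2$. Let $$\Lambda=\{3^k-3^l : k,l\in\mathbb{Z},\ 0\le l<k\}.$$ Then there exists an absolute constant $A_0>0$ such that, for all $1<p\le 2$ and all $f\in H^p(\mathbb{T}^2)$, $$\Bigg(\sum_{(m,n)\in\Lambda\times\Lambda}|\widehat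 f(m,n)|^2\Bigg)^{1/2}\le\frac{A_0}{p-1}\,\|f\|_{L^p(\mathbb{T}^2)}.$$ -/

import Mathlib

open MeasureTheory Filter Topology
open scoped ENNReal

/-- The normalised Haar measure (total mass `1`) on the torus `(ℝ/ℤ)^d`. It is the measure with
respect to which Mathlib's Fourier coefficients `UnitAddTorus.mFourierCoeff` are defined. -/
noncomputable def torusMeasure (d : Type*) [Fintype d] : Measure (UnitAddTorus d) :=
  Measure.pi fun _ => AddCircle.haarAddCircle

/-- The open unit polydisk `𝔻^d` in `ℂ^d`. -/
def polydisk (d : Type*) : Set (d → ℂ) := {z | ∀ i, ‖z i‖ < 1}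

/-- The point `(r₁ e^{2πi x₁}, …, r_d e^{2πi x_d})` of `ℂ^d`. -/
noncomputable def polarPoint {d : Type*} (r : d → ℝ) (x : UnitAddTorus d) : d → ℂ :=
  fun i => (r i : ℂ) * (AddCircle.toCircle (x i) : ℂ)

/-- The Hardy space `H^p(𝕋^d)`, `0 < p < ∞`: functions `f` on the torus that are the (almost
everywhere radial) boundary values of a holomorphic function `F` on the polydisk whose `p`-th
power means over the tori of radii `r₁, …, r_d ∈ [0, 1)` are bounded. -/
def hardySpace (d : Type*) [Fintype d] (p : ℝ) : Set (UnitAddTorus d → ℂ) :=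
  {f | ∃ F : (d → ℂ) → ℂ,
    DifferentiableOn ℂ F (polydisk d) ∧
    (⨆ r ∈ {r : d → ℝ | ∀ i, 0 ≤ r i ∧ r i < 1},
      ∫⁻ x, ‖F (polarPoint r x)‖ₑ ^ p ∂(torusMeasure d)) < ∞ ∧
    ∀ᵐ x ∂(torusMeasure d),
      Tendsto (fun r : ℝ => F (polarPoint (fun _ => r) x)) (𝓝[<] 1) (𝓝 (f x))}

/-- The set `Λ = {3^k - 3^l : k, l ∈ ℕ₀, 0 ≤ l < k}` of integers. -/
def meyerSet : Set ℤ := {m | ∃ k l : ℕ, l < k ∧ m = 3 ^ k - 3 ^ l}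

/-!
The inequality is proved in one variable with the constant `O((p - 1)⁻¹)` for the square of the norm
and then iterated.

One variable. The coefficients of a function `u` at the frequencies
`N - 3ˡ` are square summable with norm `O(√q) ‖u‖_p`, `1/p + 1/q = 1`. This is dual to Khinchin's
inequality for `∑ c_l e(3ˡx)`, which comes from a subgaussian bound by Riesz products
(`integral_rieszProduct`, `sum_sq_norm_fourierCoeff_sub_three_pow_le`). It remains to gain the sum
over `k`, and this is where analyticity enters, through a variant of the factorization proof of
Paley's inequality. If `G` has no zeros in the disk, put `φ = G^{p/2}` and `h = G^{1-p/2}`; then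
`z G' = (2/p) h · z φ'`, and for a frequency `n = 3ᵏ - 3ˡ`, which is comparable with `3ᵏ`, the
coefficient of `z G'` at `n` only sees the part `ψ_k` of `z φ'` with frequencies below `3ᵏ`.
Hölder's inequality bounds `‖h ψ_k‖_p` by `‖h‖_r ‖ψ_k‖_2`, where `1/p = 1/2 + 1/r` and `‖h‖_r` is a power
of `‖G‖_p`, and `∑ 9⁻ᵏ ‖ψ_k‖_2²` is at most a multiple of
`‖φ‖_2² = ‖G‖_p^p` (`sum_sq_norm_coeff_le_of_ne_zero`). A general polynomial `f` is the difference
`(f + 2F) - 2F` of polynomials without zeros in the disk, where `F` arises from `f` by reflecting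
its zeros in the unit circle, so that `‖f‖ ≤ ‖F‖` in the disk with equality on the circle
(`Polynomial.exists_zeroFree_majorant`).

Two variables. Since `p ≤ 2`, Minkowski's inequality `ℓ²(Lᵖ) ≤ Lᵖ(ℓ²)` allows the one-variable
estimate to be used in each variable in turn (`sum_sq_norm_iterated_fourierCoeff_le`).

Boundary values. For `s < p` the functions `F(r ·)` are uniformly integrable in `Lˢ`, so they
converge to `f` in `Lˢ`. The estimate with exponent `s` passes to the limit `r → 1`, and then `s → p`
is allowed because `‖f‖_s ≤ ‖f‖_p`. No Poisson integral representation is needed.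
-/

/-! ### Exponential sums over powers of three -/

theorem UnitAddCircle.measurePreserving_nsmul {n : ℕ} (hn : 1 < n) :
    MeasurePreserving (fun y : UnitAddCircle => n • y)
      AddCircle.haarAddCircle AddCircle.haarAddCircle := by
  have h := (AddCircle.ergodic_nsmul (T := 1) hn).toMeasurePreserving
  rw [AddCircle.volume_eq_smul_haarAddCircle] at h
  simpa using h

theorem Continuous.integrable_haarAddCircle {E : Type*} [NormedAddCommGroup E]
    {f : UnitAddCircle → E} (hf : Continuous f) : Integrable f AddCircle.haarAddCircle :=
  hf.integrable_of_hasCompactSupport (HasCompactSupport.of_compactSpace f)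

theorem norm_fourier_apply (n : ℤ) (x : UnitAddCircle) : ‖(fourier n x : ℂ)‖ = 1 := by
  rw [fourier_apply, Circle.norm_coe]

/-- A character of frequency one is orthogonal to every function of `3 • x`, because translating
by `1/3` multiplies it by a nontrivial cube root of unity and does not change `3 • x`. -/
theorem integral_comp_three_nsmul_mul_fourier_one (R : UnitAddCircle → ℂ) :
    ∫ x, R (3 • x) * fourier 1 x ∂(AddCircle.haarAddCircle : Measure UnitAddCircle) = 0 := by
  set τ : UnitAddCircle := ((1 / 3 : ℝ) : UnitAddCircle) with hτ
  have h3 : 3 • τ = 0 := by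
    rw [hτ, ← AddCircle.coe_nsmul, AddCircle.coe_eq_zero_iff]
    exact ⟨1, by norm_num⟩
  have hτ0 : τ ≠ 0 := by
    rw [hτ, Ne, AddCircle.coe_eq_zero_iff]
    rintro ⟨n, hn⟩
    rw [zsmul_eq_mul, mul_one] at hn
    have h1 : (3 * n : ℝ) = 1 := by rw [hn]; norm_num
    have h2 : 3 * n = 1 := by exact_mod_cast h1
    omega
  have hω : fourier 1 τ ≠ (1 : ℂ) := by
    rw [fourier_one]
    intro h
    apply hτ0
    apply AddCircle.injective_toCircle one_ne_zero
    rw [AddCircle.toCircle_zero]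
    exact Circle.ext h
  have key := integral_add_right_eq_self (μ := (AddCircle.haarAddCircle : Measure UnitAddCircle))
    (fun x => R (3 • x) * fourier 1 x) τ
  have h4 : ∀ x : UnitAddCircle, R (3 • (x + τ)) * fourier 1 (x + τ)
      = (R (3 • x) * fourier 1 x) * fourier 1 τ := by
    intro x
    rw [nsmul_add, h3, add_zero]
    simp only [fourier_one, AddCircle.toCircle_add, Circle.coe_mul]
    ring
  simp_rw [h4] at key
  rw [integral_mul_const] at key
  have h5 : (∫ x, R (3 • x) * fourier 1 x ∂(AddCircle.haarAddCircle : Measure UnitAddCircle))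
      * (fourier 1 τ - 1) = 0 := by rw [mul_sub, key]; ring
  exact (mul_eq_zero.mp h5).resolve_right (sub_ne_zero.mpr hω)

theorem fourier_three_pow_succ (l : ℕ) (x : UnitAddCircle) :
    (fourier (3 ^ (l + 1)) x : ℂ) = fourier (3 ^ l) (3 • x) := by
  simp only [fourier_apply]
  congr 2
  rw [pow_succ, mul_zsmul]
  norm_cast

/-- Riesz products over powers of three have mean one. -/
theorem integral_rieszProduct (L : ℕ) : ∀ b : ℕ → ℂ,
    ∫ x, ∏ l ∈ Finset.range L, (1 + (b l * fourier (3 ^ l) x).re)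
      ∂(AddCircle.haarAddCircle : Measure UnitAddCircle) = 1 := by
  induction L with
  | zero => simp
  | succ L ih =>
    intro b
    set R : UnitAddCircle → ℝ := fun x =>
      ∏ l ∈ Finset.range L, (1 + (b (l + 1) * fourier (3 ^ l) x).re) with hR
    have hRc : Continuous R := by rw [hR]; fun_prop
    have h1 : ∀ x : UnitAddCircle, ∏ l ∈ Finset.range (L + 1), (1 + (b l * fourier (3 ^ l) x).re)
        = R (3 • x) + (b 0 * ((R (3 • x) : ℂ) * fourier 1 x)).re := by
      intro x
      rw [Finset.prod_range_succ']
      simp only [fourier_three_pow_succ, pow_zero, hR]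
      rw [mul_add, mul_one]
      congr 1
      rw [← Complex.re_ofReal_mul]
      congr 1
      ring
    simp_rw [h1]
    have hc3 : Continuous fun x : UnitAddCircle => R (3 • x) := hRc.comp (continuous_nsmul 3)
    have hc4 : Continuous fun x : UnitAddCircle => b 0 * ((R (3 • x) : ℂ) * fourier 1 x) := by
      fun_prop
    rw [integral_add (g := fun x : UnitAddCircle => (b 0 * ((R (3 • x) : ℂ) * fourier 1 x)).re)
      hc3.integrable_haarAddCircle (Complex.continuous_re.comp hc4).integrable_haarAddCircle]
    have h2 : ∫ x, (b 0 * ((R (3 • x) : ℂ) * fourier 1 x)).re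
        ∂(AddCircle.haarAddCircle : Measure UnitAddCircle) = 0 := by
      have := integral_re (𝕜 := ℂ) hc4.integrable_haarAddCircle
      simp only [RCLike.re_to_complex] at this
      rw [this, integral_const_mul,
        integral_comp_three_nsmul_mul_fourier_one (fun x => (R x : ℂ))]
      simp
    have hmp := UnitAddCircle.measurePreserving_nsmul (n := 3) (by norm_num)
    have h3 : ∫ x, R (3 • x) ∂(AddCircle.haarAddCircle : Measure UnitAddCircle)
        = ∫ x, R x ∂(AddCircle.haarAddCircle : Measure UnitAddCircle) := by
      conv_rhs => rw [← hmp.map_eq]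
      rw [integral_map hmp.measurable.aemeasurable hRc.aestronglyMeasurable]
    rw [h2, h3, add_zero]
    exact ih fun l => b (l + 1)

/-- The chord bound for `exp` on `[-a, a]`. -/
theorem Real.exp_mul_le_cosh_add {a t : ℝ} (ht : |t| ≤ 1) :
    Real.exp (a * t) ≤ Real.cosh a + t * Real.sinh a := by
  obtain ⟨h1, h2⟩ := abs_le.mp ht
  have h := convexOn_exp.2 (Set.mem_univ a) (Set.mem_univ (-a))
    (show 0 ≤ (1 + t) / 2 by linarith) (show 0 ≤ (1 - t) / 2 by linarith) (by ring)
  simp only [smul_eq_mul] at h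
  rw [Real.cosh_eq, Real.sinh_eq]
  calc Real.exp (a * t) = Real.exp ((1 + t) / 2 * a + (1 - t) / 2 * -a) := by congr 1; ring
    _ ≤ _ := h
    _ = _ := by ring

/-- Exponential sums over powers of three are subgaussian. -/
theorem integral_exp_re_lacunary_le (L : ℕ) (c : ℕ → ℂ) :
    ∫ x, Real.exp (∑ l ∈ Finset.range L, (c l * fourier (3 ^ l) x).re)
      ∂(AddCircle.haarAddCircle : Measure UnitAddCircle)
      ≤ Real.exp ((∑ l ∈ Finset.range L, ‖c l‖ ^ 2) / 2) := by
  -- `b l` is `tanh ‖c l‖` times the phase of `c l`.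
  set b : ℕ → ℂ := fun l =>
    (Real.sinh ‖c l‖ / Real.cosh ‖c l‖ : ℝ) * ((‖c l‖⁻¹ : ℝ) * c l) with hb
  have hpt : ∀ x : UnitAddCircle, Real.exp (∑ l ∈ Finset.range L, (c l * fourier (3 ^ l) x).re)
      ≤ (∏ l ∈ Finset.range L, Real.cosh ‖c l‖) *
        ∏ l ∈ Finset.range L, (1 + (b l * fourier (3 ^ l) x).re) := by
    intro x
    rw [Real.exp_sum, ← Finset.prod_mul_distrib]
    refine Finset.prod_le_prod (fun _ _ => (Real.exp_pos _).le) fun l _ => ?_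
    set t : ℝ := (((‖c l‖⁻¹ : ℝ) * c l) * fourier (3 ^ l) x).re with ht
    have ht1 : |t| ≤ 1 := by
      refine (Complex.abs_re_le_norm _).trans ?_
      rw [norm_mul, norm_mul, fourier_apply, Circle.norm_coe, mul_one, Complex.norm_real,
        norm_inv, norm_norm]
      exact inv_mul_le_one
    have h1 : (c l * fourier (3 ^ l) x).re = ‖c l‖ * t := by
      rw [ht, ← Complex.re_ofReal_mul]
      congr 1
      rcases eq_or_ne (c l) 0 with h | h
      · simp [h]
      · have : (‖c l‖ : ℂ) ≠ 0 := by simpa using h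
        push_cast
        field_simp
    have h2 : (b l * fourier (3 ^ l) x).re = Real.sinh ‖c l‖ / Real.cosh ‖c l‖ * t := by
      rw [hb, ht, ← Complex.re_ofReal_mul]
      congr 1
      ring
    rw [h1, h2]
    refine (Real.exp_mul_le_cosh_add ht1).trans (le_of_eq ?_)
    have := (Real.cosh_pos ‖c l‖).ne'
    field_simp
  have hcL : Continuous fun x : UnitAddCircle =>
      Real.exp (∑ l ∈ Finset.range L, (c l * fourier (3 ^ l) x).re) := by fun_prop
  have hcR : Continuous fun x : UnitAddCircle => (∏ l ∈ Finset.range L, Real.cosh ‖c l‖) *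
        ∏ l ∈ Finset.range L, (1 + (b l * fourier (3 ^ l) x).re) := by fun_prop
  refine (integral_mono hcL.integrable_haarAddCircle hcR.integrable_haarAddCircle hpt).trans ?_
  rw [integral_const_mul, integral_rieszProduct, mul_one, Finset.sum_div, Real.exp_sum]
  exact Finset.prod_le_prod (fun _ _ => (Real.cosh_pos _).le)
    fun _ _ => Real.cosh_le_exp_half_sq _

/-- The modulus of `w` is at most `√2` times the largest of `± re w` and `± im w`. -/
theorem exp_mul_norm_le_sum_exp_re (w : ℂ) {s : ℝ} (hs : 0 ≤ s) :
    Real.exp (s * ‖w‖) ≤ Real.exp ((((√2 * s : ℝ) : ℂ) * w).re)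
      + Real.exp (((-(√2 * s : ℝ) : ℂ) * w).re)
      + Real.exp ((((√2 * s : ℝ) * Complex.I : ℂ) * w).re)
      + Real.exp ((-((√2 * s : ℝ) * Complex.I : ℂ) * w).re) := by
  have h2 : √2 * √2 = 2 := Real.mul_self_sqrt (by norm_num)
  have hmax : s * ‖w‖ ≤ √2 * s * |w.re| ∨ s * ‖w‖ ≤ √2 * s * |w.im| := by
    have hn : ‖w‖ ≤ √2 * |w.re| ∨ ‖w‖ ≤ √2 * |w.im| := by
      rcases le_total |w.im| |w.re| with h | h
      · left
        apply le_of_sq_le_sq _ (by positivity)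
        rw [← Complex.normSq_eq_norm_sq, Complex.normSq_apply]
        nlinarith [sq_abs w.re, sq_abs w.im, abs_nonneg w.re, abs_nonneg w.im]
      · right
        apply le_of_sq_le_sq _ (by positivity)
        rw [← Complex.normSq_eq_norm_sq, Complex.normSq_apply]
        nlinarith [sq_abs w.re, sq_abs w.im, abs_nonneg w.re, abs_nonneg w.im]
    rcases hn with h | h
    · left; nlinarith
    · right; nlinarith
  have e1 : ((((√2 * s : ℝ) : ℂ) * w).re) = √2 * s * w.re := Complex.re_ofReal_mul _ _
  have e2 : (((-(√2 * s : ℝ) : ℂ) * w).re) = -(√2 * s * w.re) := by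
    rw [neg_mul, Complex.neg_re, Complex.re_ofReal_mul]
  have e3 : ((((√2 * s : ℝ) * Complex.I : ℂ) * w).re) = -(√2 * s * w.im) := by
    rw [mul_assoc, Complex.re_ofReal_mul]; simp
  have e4 : ((-((√2 * s : ℝ) * Complex.I : ℂ) * w).re) = √2 * s * w.im := by
    rw [neg_mul, Complex.neg_re, mul_assoc, Complex.re_ofReal_mul]; simp
  rw [e1, e2, e3, e4]
  have p1 := Real.exp_pos (√2 * s * w.re)
  have p2 := Real.exp_pos (-(√2 * s * w.re))
  have p3 := Real.exp_pos (√2 * s * w.im)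
  have p4 := Real.exp_pos (-(√2 * s * w.im))
  rcases hmax with h | h
  · have := Real.exp_le_exp.mpr h
    rcases abs_choice w.re with h' | h' <;> rw [h'] at this
    · linarith
    · rw [mul_neg] at this; linarith
  · have := Real.exp_le_exp.mpr h
    rcases abs_choice w.im with h' | h' <;> rw [h'] at this
    · linarith
    · rw [mul_neg] at this; linarith

theorem integral_exp_norm_lacunary_le (L : ℕ) (c : ℕ → ℂ) {s : ℝ} (hs : 0 ≤ s) :
    ∫ x, Real.exp (s * ‖∑ l ∈ Finset.range L, c l * fourier (3 ^ l) x‖)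
      ∂(AddCircle.haarAddCircle : Measure UnitAddCircle)
      ≤ 4 * Real.exp (s ^ 2 * ∑ l ∈ Finset.range L, ‖c l‖ ^ 2) := by
  have key : ∀ a : ℂ, ‖a‖ = √2 * s →
      Integrable (fun x : UnitAddCircle =>
        Real.exp ((a * ∑ l ∈ Finset.range L, c l * fourier (3 ^ l) x).re))
        AddCircle.haarAddCircle ∧
      ∫ x, Real.exp ((a * ∑ l ∈ Finset.range L, c l * fourier (3 ^ l) x).re)
        ∂(AddCircle.haarAddCircle : Measure UnitAddCircle)
        ≤ Real.exp (s ^ 2 * ∑ l ∈ Finset.range L, ‖c l‖ ^ 2) := by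
    intro a ha
    constructor
    · apply Continuous.integrable_haarAddCircle
      fun_prop
    · have h := integral_exp_re_lacunary_le L fun l => a * c l
      have e1 : ∀ x : UnitAddCircle, (a * ∑ l ∈ Finset.range L, c l * fourier (3 ^ l) x).re
          = ∑ l ∈ Finset.range L, (a * c l * fourier (3 ^ l) x).re := by
        intro x
        rw [Finset.mul_sum, Complex.re_sum]
        simp_rw [mul_assoc]
      simp_rw [e1]
      refine h.trans (le_of_eq ?_)
      congr 1
      simp_rw [norm_mul, mul_pow, ha, mul_pow, Real.sq_sqrt (show (0 : ℝ) ≤ 2 by norm_num)]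
      rw [← Finset.mul_sum]
      ring
  have n1 : ‖((√2 * s : ℝ) : ℂ)‖ = √2 * s := by
    rw [Complex.norm_real, Real.norm_of_nonneg (by positivity)]
  obtain ⟨i1, b1⟩ := key ((√2 * s : ℝ) : ℂ) n1
  obtain ⟨i2, b2⟩ := key (-(√2 * s : ℝ) : ℂ) (by rw [norm_neg, n1])
  obtain ⟨i3, b3⟩ := key ((√2 * s : ℝ) * Complex.I : ℂ) (by rw [norm_mul, n1]; simp)
  obtain ⟨i4, b4⟩ := key (-((√2 * s : ℝ) * Complex.I : ℂ)) (by rw [norm_neg, norm_mul, n1]; simp)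
  have hc : Continuous fun x : UnitAddCircle =>
      Real.exp (s * ‖∑ l ∈ Finset.range L, c l * fourier (3 ^ l) x‖) := by fun_prop
  refine (integral_mono hc.integrable_haarAddCircle (((i1.add i2).add i3).add i4)
    fun x => exp_mul_norm_le_sum_exp_re _ hs).trans ?_
  rw [integral_add' ((i1.add i2).add i3) i4, integral_add' (i1.add i2) i3, integral_add' i1 i2]
  linarith

/-- Khinchin's inequality for exponential sums over powers of three, with the sharp growth `√q` of
the constant. -/
theorem integral_norm_rpow_lacunary_le (L : ℕ) (c : ℕ → ℂ) {q : ℝ} (hq : 2 ≤ q) :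
    ∫ x, ‖∑ l ∈ Finset.range L, c l * fourier (3 ^ l) x‖ ^ q
      ∂(AddCircle.haarAddCircle : Measure UnitAddCircle)
      ≤ (Real.exp 4 * q * ∑ l ∈ Finset.range L, ‖c l‖ ^ 2) ^ (q / 2) := by
  set V := ∑ l ∈ Finset.range L, ‖c l‖ ^ 2 with hV
  have hV0 : 0 ≤ V := Finset.sum_nonneg fun _ _ => by positivity
  rcases hV0.eq_or_lt with h0 | hpos
  · have hc : ∀ l ∈ Finset.range L, c l = 0 := by
      intro l hl
      have := (Finset.sum_eq_zero_iff_of_nonneg (fun _ _ => by positivity)).mp h0.symm l hl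
      simpa using this
    have : ∀ x : UnitAddCircle, ∑ l ∈ Finset.range L, c l * fourier (3 ^ l) x = 0 := by
      intro x
      exact Finset.sum_eq_zero fun l hl => by rw [hc l hl, zero_mul]
    simp_rw [this]
    rw [norm_zero, Real.zero_rpow (by linarith), integral_zero, ← h0, mul_zero,
      Real.zero_rpow (by linarith)]
  · have hq0 : 0 < q := by linarith
    -- the exponential moment of order `s = √(q / V)` balances the two factors below
    set s : ℝ := √(q / V) with hs
    have hs0 : 0 < s := Real.sqrt_pos.mpr (by positivity)
    have hs2 : s ^ 2 = q / V := Real.sq_sqrt (by positivity)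
    have hpt : ∀ t : ℝ, 0 ≤ t → t ^ q ≤ (q / s) ^ q * Real.exp (s * t) := by
      intro t ht
      have h1 : s * t / q ≤ Real.exp (s * t / q) := by
        linarith [Real.add_one_le_exp (s * t / q)]
      have h2 := Real.rpow_le_rpow (by positivity) h1 hq0.le
      rw [← Real.exp_mul, div_mul_cancel₀ _ hq0.ne'] at h2
      calc t ^ q = (q / s * (s * t / q)) ^ q := by congr 1; field_simp
        _ = (q / s) ^ q * (s * t / q) ^ q := Real.mul_rpow (by positivity) (by positivity)
        _ ≤ _ := by gcongr
    have hc : Continuous fun x : UnitAddCircle =>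
        ‖∑ l ∈ Finset.range L, c l * fourier (3 ^ l) x‖ ^ q :=
      Continuous.rpow_const (by fun_prop) fun _ => Or.inr hq0.le
    have hc' : Continuous fun x : UnitAddCircle =>
        (q / s) ^ q * Real.exp (s * ‖∑ l ∈ Finset.range L, c l * fourier (3 ^ l) x‖) := by
      fun_prop
    refine (integral_mono hc.integrable_haarAddCircle hc'.integrable_haarAddCircle
      fun x => hpt _ (norm_nonneg _)).trans ?_
    rw [integral_const_mul]
    have h3 := integral_exp_norm_lacunary_le L c hs0.le
    rw [← hV, hs2, div_mul_cancel₀ _ hpos.ne'] at h3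
    have h4 : (4 : ℝ) ≤ Real.exp q := by
      have h5 : (2 : ℝ) ≤ Real.exp 1 := by linarith [Real.add_one_le_exp (1 : ℝ)]
      calc (4 : ℝ) ≤ Real.exp 1 * Real.exp 1 := by nlinarith
        _ = Real.exp 2 := by rw [← Real.exp_add]; norm_num
        _ ≤ _ := Real.exp_le_exp.mpr hq
    have h6 : (q / s) ^ q = (q * V) ^ (q / 2) := by
      have : q / s = √(q * V) := by
        rw [eq_comm, Real.sqrt_eq_iff_mul_self_eq (by positivity) (by positivity)]
        field_simp
        rw [hs2]
        field_simp
      rw [this, Real.sqrt_eq_rpow, ← Real.rpow_mul (by positivity)]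
      congr 1
      ring
    calc (q / s) ^ q * _ ≤ (q * V) ^ (q / 2) * (Real.exp q * Real.exp q) := by
          rw [h6]
          gcongr
          exact h3.trans (by gcongr)
      _ = (Real.exp 4 * q * V) ^ (q / 2) := by
          rw [mul_assoc (Real.exp 4), Real.mul_rpow (Real.exp_pos _).le (by positivity),
            ← Real.exp_mul, ← Real.exp_add, mul_comm]
          congr 2
          ring

/-- The dual form of Khinchin's inequality: the coefficients of `u` at the frequencies `N - 3 ^ l`
are square summable, with a constant that is linear in the conjugate exponent `q`. -/
theorem sum_sq_norm_fourierCoeff_sub_three_pow_le {p q : ℝ} (hpq : p.HolderConjugate q)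
    (hq : 2 ≤ q) {u : UnitAddCircle → ℂ} (hu : Continuous u) (N : ℤ) (L : ℕ) :
    ∑ l ∈ Finset.range L, ‖fourierCoeff u (N - 3 ^ l)‖ ^ 2
      ≤ Real.exp 4 * q * (∫ x, ‖u x‖ ^ p ∂AddCircle.haarAddCircle) ^ (2 / p) := by
  set v : ℕ → ℂ := fun l => fourierCoeff u (N - 3 ^ l) with hv
  set V := ∑ l ∈ Finset.range L, ‖v l‖ ^ 2 with hV
  have hV0 : 0 ≤ V := Finset.sum_nonneg fun _ _ => by positivity
  have hp0 : 0 < p := hpq.pos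
  have hq0 : 0 < q := by linarith
  set w : UnitAddCircle → ℂ := fun x =>
    ∑ l ∈ Finset.range L, (starRingEnd ℂ (v l)) * fourier (3 ^ l) x with hw
  have hwc : Continuous w := by rw [hw]; fun_prop
  set I := ∫ x, ‖u x‖ ^ p ∂(AddCircle.haarAddCircle : Measure UnitAddCircle) with hI
  have hI0 : 0 ≤ I := integral_nonneg fun _ => by positivity
  have h1 : (V : ℂ) = ∫ x, fourier (-N) x * u x * w x
      ∂(AddCircle.haarAddCircle : Measure UnitAddCircle) := by
    have : ∀ x : UnitAddCircle, fourier (-N) x * u x * w x =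
        ∑ l ∈ Finset.range L, (starRingEnd ℂ (v l)) * (fourier (-(N - 3 ^ l)) x • u x) := by
      intro x
      rw [hw]
      simp only [Finset.mul_sum]
      refine Finset.sum_congr rfl fun l _ => ?_
      rw [show -(N - 3 ^ l : ℤ) = -N + 3 ^ l by ring, fourier_add, smul_eq_mul]
      ring
    simp_rw [this]
    rw [integral_finsetSum]
    · rw [hV]
      push_cast
      refine Finset.sum_congr rfl fun l _ => ?_
      rw [integral_const_mul]
      change _ = _ * v l
      rw [mul_comm]
      exact (Complex.mul_conj' (v l)).symm
    · intro l _
      apply Continuous.integrable_haarAddCircle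
      fun_prop
  have h2 : V ≤ ∫ x, ‖u x‖ * ‖w x‖ ∂(AddCircle.haarAddCircle : Measure UnitAddCircle) := by
    have : ‖(V : ℂ)‖ = V := by rw [Complex.norm_real, Real.norm_of_nonneg hV0]
    rw [← this, h1]
    refine (norm_integral_le_integral_norm _).trans (le_of_eq ?_)
    refine integral_congr_ae (Eventually.of_forall fun x => ?_)
    dsimp only
    rw [norm_mul, norm_mul, norm_fourier_apply, one_mul]
  have h3 := integral_mul_norm_le_Lp_mul_Lq hpq (f := u) (g := w)
    (μ := (AddCircle.haarAddCircle : Measure UnitAddCircle))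
    (hu.memLp_of_hasCompactSupport (HasCompactSupport.of_compactSpace _))
    (hwc.memLp_of_hasCompactSupport (HasCompactSupport.of_compactSpace _))
  have h4 : (∫ x, ‖w x‖ ^ q ∂(AddCircle.haarAddCircle : Measure UnitAddCircle)) ^ (1 / q)
      ≤ √(Real.exp 4 * q * V) := by
    have := integral_norm_rpow_lacunary_le L (fun l => starRingEnd ℂ (v l)) hq
    simp only [RCLike.norm_conj] at this
    calc _ ≤ ((Real.exp 4 * q * V) ^ (q / 2)) ^ (1 / q) := by
          refine Real.rpow_le_rpow (integral_nonneg fun _ => by positivity) this (by positivity)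
      _ = _ := by
          rw [← Real.rpow_mul (by positivity), Real.sqrt_eq_rpow]
          congr 1
          field_simp
  have h5 : V ≤ I ^ (1 / p) * √(Real.exp 4 * q * V) :=
    h2.trans (h3.trans (mul_le_mul_of_nonneg_left h4 (Real.rpow_nonneg hI0 _)))
  have h6 : I ^ (2 / p) = (I ^ (1 / p)) ^ 2 := by
    rw [← Real.rpow_natCast, ← Real.rpow_mul hI0]
    congr 1
    push_cast
    ring
  rw [h6]
  rcases hV0.eq_or_lt with h0 | hpos
  · rw [← h0]; positivity
  · rw [Real.sqrt_mul (by positivity)] at h5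
    have h7 : √V ≤ I ^ (1 / p) * √(Real.exp 4 * q) := by
      have : 0 < √V := Real.sqrt_pos.mpr hpos
      have h8 : √V * √V = V := Real.mul_self_sqrt hV0
      by_contra! hlt
      nlinarith
    calc V = √V ^ 2 := (Real.sq_sqrt hV0).symm
      _ ≤ (I ^ (1 / p) * √(Real.exp 4 * q)) ^ 2 := by gcongr
      _ = _ := by rw [mul_pow, Real.sq_sqrt (by positivity)]; ring

/-! ### Absolutely convergent Fourier series of analytic type -/

theorem HasSum.congr_terms {ι : Type*} {f g : ι → ℂ} {a : ℂ} (h : HasSum f a)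
    (e : ∀ i, f i = g i) : HasSum g a :=
  funext e ▸ h

theorem fourier_natCast_apply (n : ℕ) (x : UnitAddCircle) :
    (fourier (n : ℤ) x : ℂ) = fourier 1 x ^ n := by
  rw [fourier_apply, fourier_one, natCast_zsmul, AddCircle.toCircle_nsmul, Circle.coe_pow]

/-- The function `f` on the circle is the sum of the absolutely convergent Fourier series
`∑ a n e^{2πinx}`, which has no negative frequencies. -/
def IsAnalyticSeries (f : UnitAddCircle → ℂ) (a : ℕ → ℂ) : Prop :=
  Summable (fun n => ‖a n‖) ∧ ∀ x, HasSum (fun n : ℕ => a n * fourier (n : ℤ) x) (f x)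

namespace IsAnalyticSeries

variable {f g : UnitAddCircle → ℂ} {a b : ℕ → ℂ}

theorem norm_term (a : ℕ → ℂ) (n : ℕ) (x : UnitAddCircle) :
    ‖a n * fourier (n : ℤ) x‖ = ‖a n‖ := by
  rw [norm_mul, norm_fourier_apply, mul_one]

theorem tendstoUniformly (h : IsAnalyticSeries f a) :
    TendstoUniformly (fun N x => ∑ n ∈ Finset.range N, a n * fourier (n : ℤ) x) f atTop := by
  have := tendstoUniformly_tsum_nat (f := fun (n : ℕ) (x : UnitAddCircle) =>
    a n * fourier (n : ℤ) x) h.1 fun n x => (norm_term a n x).le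
  convert this using 1
  ext x
  exact ((h.2 x).tsum_eq).symm

theorem continuous (h : IsAnalyticSeries f a) : Continuous f :=
  h.tendstoUniformly.continuous (Eventually.of_forall fun N => by fun_prop).frequently

theorem hasSum_fourierCoeff (h : IsAnalyticSeries f a) (m : ℤ) :
    HasSum (fun n : ℕ => a n * (Pi.single (n : ℤ) 1 : ℤ → ℂ) m) (fourierCoeff f m) := by
  have hi : ∀ n : ℕ, Integrable (fun x : UnitAddCircle =>
      fourier (-m) x • (a n * fourier (n : ℤ) x)) AddCircle.haarAddCircle := by
    intro n
    apply Continuous.integrable_haarAddCircle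
    fun_prop
  have hn : ∀ (n : ℕ) (x : UnitAddCircle), ‖fourier (-m) x • (a n * fourier (n : ℤ) x)‖ = ‖a n‖ := by
    intro n x
    rw [norm_smul, norm_fourier_apply, one_mul, norm_term]
  have hs : Summable fun n : ℕ => ∫ x, ‖fourier (-m) x • (a n * fourier (n : ℤ) x)‖
      ∂(AddCircle.haarAddCircle : Measure UnitAddCircle) := by
    simp_rw [hn]
    simpa using h.1
  have key := hasSum_integral_of_summable_integral_norm hi hs
  have e1 : ∀ n : ℕ, ∫ x, fourier (-m) x • (a n * fourier (n : ℤ) x)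
      ∂(AddCircle.haarAddCircle : Measure UnitAddCircle)
      = a n * (Pi.single (n : ℤ) 1 : ℤ → ℂ) m := by
    intro n
    rw [← fourierCoeff_fourier (T := 1)]
    change _ = a n * ∫ x, fourier (-m) x • fourier (n : ℤ) x
      ∂(AddCircle.haarAddCircle : Measure UnitAddCircle)
    rw [← integral_const_mul]
    refine integral_congr_ae (Eventually.of_forall fun x => ?_)
    simp only [smul_eq_mul]
    ring
  have e2 : ∫ x, ∑' n : ℕ, fourier (-m) x • (a n * fourier (n : ℤ) x)
      ∂(AddCircle.haarAddCircle : Measure UnitAddCircle) = fourierCoeff f m :=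
    integral_congr_ae (Eventually.of_forall fun x =>
      ((h.2 x).const_smul (fourier (-m) x)).tsum_eq)
  rw [e2] at key
  exact key.congr_terms e1

theorem fourierCoeff_natCast (h : IsAnalyticSeries f a) (n : ℕ) :
    fourierCoeff f (n : ℤ) = a n := by
  refine (h.hasSum_fourierCoeff n).unique ?_
  convert hasSum_ite_eq n (a n) using 1
  ext j
  rcases eq_or_ne j n with rfl | hj
  · simp
  · simp [hj, hj.symm]

theorem fourierCoeff_of_notMem_range (h : IsAnalyticSeries f a) {m : ℤ}
    (hm : m ∉ Set.range ((↑) : ℕ → ℤ)) : fourierCoeff f m = 0 := by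
  refine (h.hasSum_fourierCoeff m).unique ?_
  convert hasSum_zero using 1
  ext j
  have : m ≠ j := fun h => hm ⟨j, h.symm⟩
  simp [this]

theorem hasSum_sq_norm (h : IsAnalyticSeries f a) :
    HasSum (fun n => ‖a n‖ ^ 2) (∫ x, ‖f x‖ ^ 2 ∂AddCircle.haarAddCircle) := by
  set F : C(UnitAddCircle, ℂ) := ⟨f, h.continuous⟩
  have h1 := hasSum_sq_fourierCoeff (ContinuousMap.toLp (E := ℂ) 2 AddCircle.haarAddCircle ℂ F)
  simp_rw [fourierCoeff_toLp] at h1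
  have h2 : ∫ t, ‖(ContinuousMap.toLp (E := ℂ) 2 AddCircle.haarAddCircle ℂ F) t‖ ^ 2
      ∂(AddCircle.haarAddCircle : Measure UnitAddCircle)
      = ∫ x, ‖f x‖ ^ 2 ∂AddCircle.haarAddCircle := by
    refine integral_congr_ae ?_
    filter_upwards [ContinuousMap.coeFn_toLp (p := 2) (𝕜 := ℂ) AddCircle.haarAddCircle F]
      with x hx
    rw [hx]
    rfl
  rw [h2] at h1
  have h3 := (Nat.cast_injective (R := ℤ)).hasSum_iff
    (f := fun i : ℤ => ‖fourierCoeff F i‖ ^ 2) (a := ∫ x, ‖f x‖ ^ 2 ∂AddCircle.haarAddCircle) ?_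
  · rw [← h3] at h1
    convert h1 using 1
    ext n
    simp only [Function.comp_apply]
    rw [← h.fourierCoeff_natCast n]
    rfl
  · intro m hm
    have := h.fourierCoeff_of_notMem_range hm
    change ‖fourierCoeff f m‖ ^ 2 = 0
    rw [this]
    simp

theorem mul (hf : IsAnalyticSeries f a) (hg : IsAnalyticSeries g b) :
    IsAnalyticSeries (fun x => f x * g x)
      (fun n => ∑ ij ∈ Finset.HasAntidiagonal.antidiagonal n, a ij.1 * b ij.2) := by
  refine ⟨summable_norm_sum_mul_antidiagonal_of_summable_norm hf.1 hg.1, fun x => ?_⟩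
  have ha : Summable fun n : ℕ => ‖a n * fourier (n : ℤ) x‖ := by
    simp_rw [norm_term]; exact hf.1
  have hb : Summable fun n : ℕ => ‖b n * fourier (n : ℤ) x‖ := by
    simp_rw [norm_term]; exact hg.1
  have h1 := (summable_norm_sum_mul_antidiagonal_of_summable_norm ha hb).of_norm.hasSum
  rw [← tsum_mul_tsum_eq_tsum_sum_antidiagonal_of_summable_norm ha hb, (hf.2 x).tsum_eq,
    (hg.2 x).tsum_eq] at h1
  refine h1.congr_terms fun n => ?_
  rw [Finset.sum_mul]
  refine Finset.sum_congr rfl fun ij hij => ?_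
  rw [← Finset.HasAntidiagonal.mem_antidiagonal.mp hij]
  push_cast
  rw [fourier_add]
  ring

theorem const_mul (h : IsAnalyticSeries f a) (c : ℂ) :
    IsAnalyticSeries (fun x => c * f x) (fun n => c * a n) := by
  refine ⟨by simpa [norm_mul] using h.1.mul_left ‖c‖, fun x => ?_⟩
  simpa [mul_assoc] using (h.2 x).mul_left c

/-- Analytic series are determined by their sums. -/
theorem coeff_unique (hf : IsAnalyticSeries f a) (hg : IsAnalyticSeries f b) : a = b := by
  ext n
  rw [← hf.fourierCoeff_natCast, hg.fourierCoeff_natCast]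

theorem of_sum_range (a : ℕ → ℂ) (N : ℕ) :
    IsAnalyticSeries (fun x => ∑ n ∈ Finset.range N, a n * fourier (n : ℤ) x)
      (fun n => if n < N then a n else 0) := by
  have h0 : ∀ n ∉ Finset.range N, (if n < N then a n else 0) = 0 := by
    intro n hn
    rw [if_neg (by simpa using hn)]
  refine ⟨summable_of_ne_finset_zero (s := Finset.range N) fun n hn => ?_, fun x => ?_⟩
  · dsimp only
    rw [h0 n hn, norm_zero]
  have : ∑ n ∈ Finset.range N, a n * fourier (n : ℤ) x
      = ∑ n ∈ Finset.range N, (if n < N then a n else 0) * fourier (n : ℤ) x :=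
    Finset.sum_congr rfl fun n hn => by rw [if_pos (Finset.mem_range.mp hn)]
  dsimp only
  rw [this]
  exact hasSum_sum_of_ne_finset_zero fun n hn => by rw [h0 n hn, zero_mul]

theorem of_polynomial (P : Polynomial ℂ) :
    IsAnalyticSeries (fun x => P.eval (fourier 1 x)) P.coeff := by
  have h := of_sum_range P.coeff (P.natDegree + 1)
  convert h using 1
  · ext x
    rw [Polynomial.eval_eq_sum_range]
    simp_rw [fourier_natCast_apply]
  · ext n
    split_ifs with hn
    · rfl
    · exact Polynomial.coeff_eq_zero_of_natDegree_lt (by omega)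

/-- Taylor's series on a circle inside the disk of holomorphy. -/
theorem of_differentiableOn {G : ℂ → ℂ} {R r : ℝ} (hG : DifferentiableOn ℂ G (Metric.ball 0 R))
    (hr0 : 0 ≤ r) (hr : r < R) :
    IsAnalyticSeries (fun x => G (r * fourier 1 x))
      (fun n => (n.factorial : ℂ)⁻¹ * iteratedDeriv n G 0 * r ^ n) := by
  constructor
  · have hz : (r : ℂ) ∈ Metric.ball (0 : ℂ) R := by
      rw [mem_ball_zero_iff, Complex.norm_real, Real.norm_of_nonneg hr0]
      exact hr
    have := (Complex.hasSum_taylorSeries_on_ball hG hz).summable.norm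
    refine this.congr fun n => ?_
    simp only [sub_zero, smul_eq_mul]
    congr 1
    ring
  · intro x
    have hz : (r : ℂ) * fourier 1 x ∈ Metric.ball (0 : ℂ) R := by
      rw [mem_ball_zero_iff, norm_mul, norm_fourier_apply, Complex.norm_real,
        Real.norm_of_nonneg hr0, mul_one]
      exact hr
    refine (Complex.hasSum_taylorSeries_on_ball hG hz).congr_terms fun n => ?_
    rw [fourier_natCast_apply]
    simp only [sub_zero, smul_eq_mul, mul_pow]
    ring

/-- The Taylor series of `z G'(z)` has the coefficients `n a n`. -/
theorem exists_of_differentiableOn {G : ℂ → ℂ} {R : ℝ}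
    (hG : DifferentiableOn ℂ G (Metric.ball 0 R)) (hR : 1 < R) :
    ∃ a : ℕ → ℂ, IsAnalyticSeries (fun x => G (fourier 1 x)) a ∧
      IsAnalyticSeries (fun x => fourier 1 x * deriv G (fourier 1 x)) (fun n => n * a n) := by
  have h1 := of_differentiableOn hG zero_le_one hR
  have h2 := of_differentiableOn (hG.deriv Metric.isOpen_ball) zero_le_one hR
  simp only [Complex.ofReal_one, one_mul, one_pow, mul_one] at h1 h2
  refine ⟨_, h1, ?_⟩
  set a : ℕ → ℂ := fun n => (n.factorial : ℂ)⁻¹ * iteratedDeriv n G 0 with ha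
  have h3 : ∀ n : ℕ, (n.factorial : ℂ)⁻¹ * iteratedDeriv n (deriv G) 0
      = ((n + 1 : ℕ) : ℂ) * a (n + 1) := by
    intro n
    rw [ha, ← iteratedDeriv_succ']
    simp only [Nat.factorial_succ]
    have : ((n : ℂ) + 1) ≠ 0 := by exact_mod_cast n.succ_ne_zero
    have : (n.factorial : ℂ) ≠ 0 := by exact_mod_cast n.factorial_ne_zero
    push_cast
    field_simp
  simp_rw [h3] at h2
  constructor
  · exact (summable_nat_add_iff (f := fun n : ℕ => ‖(n : ℂ) * a n‖) 1).mp h2.1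
  · intro x
    have h4 := (h2.2 x).mul_left (fourier 1 x)
    have h5 := (hasSum_nat_add_iff (f := fun n : ℕ => (n : ℂ) * a n * fourier (n : ℤ) x)
      (g := fourier 1 x * deriv G (fourier 1 x)) 1).mp ?_
    · simpa using h5
    · refine h4.congr_terms fun n => ?_
      simp_rw [fourier_natCast_apply, pow_succ]
      ring

end IsAnalyticSeries

/-! ### The estimate for functions without zeros in the disk -/

theorem integral_rpow_mul_rpow_le {f g : UnitAddCircle → ℝ} (hf : Continuous f)
    (hg : Continuous g) (hf0 : ∀ x, 0 ≤ f x) (hg0 : ∀ x, 0 ≤ g x) {s t : ℝ} (hs : 0 ≤ s)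
    (ht : 0 ≤ t) (hst : s + t = 1) :
    ∫ x, f x ^ s * g x ^ t ∂AddCircle.haarAddCircle
      ≤ (∫ x, f x ∂AddCircle.haarAddCircle) ^ s * (∫ x, g x ∂AddCircle.haarAddCircle) ^ t := by
  have h := ENNReal.lintegral_mul_norm_pow_le
    (μ := (AddCircle.haarAddCircle : Measure UnitAddCircle))
    (f := fun x => ENNReal.ofReal (f x)) (g := fun x => ENNReal.ofReal (g x))
    hf.measurable.ennreal_ofReal.aemeasurable hg.measurable.ennreal_ofReal.aemeasurable hs ht hst
  rw [← ofReal_integral_eq_lintegral_ofReal hf.integrable_haarAddCircle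
      (Eventually.of_forall hf0),
    ← ofReal_integral_eq_lintegral_ofReal hg.integrable_haarAddCircle (Eventually.of_forall hg0),
    ENNReal.ofReal_rpow_of_nonneg (integral_nonneg hf0) hs,
    ENNReal.ofReal_rpow_of_nonneg (integral_nonneg hg0) ht,
    ← ENNReal.ofReal_mul (Real.rpow_nonneg (integral_nonneg hf0) _)] at h
  have h2 : ∀ x, ENNReal.ofReal (f x) ^ s * ENNReal.ofReal (g x) ^ t
      = ENNReal.ofReal (f x ^ s * g x ^ t) := by
    intro x
    rw [ENNReal.ofReal_rpow_of_nonneg (hf0 x) hs, ENNReal.ofReal_rpow_of_nonneg (hg0 x) ht,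
      ← ENNReal.ofReal_mul (Real.rpow_nonneg (hf0 x) _)]
  simp_rw [h2] at h
  have hc : Continuous fun x => f x ^ s * g x ^ t :=
    (hf.rpow_const fun _ => Or.inr hs).mul (hg.rpow_const fun _ => Or.inr ht)
  rw [← ofReal_integral_eq_lintegral_ofReal hc.integrable_haarAddCircle
    (Eventually.of_forall fun x =>
      mul_nonneg (Real.rpow_nonneg (hf0 x) _) (Real.rpow_nonneg (hg0 x) _))] at h
  exact (ENNReal.ofReal_le_ofReal_iff (mul_nonneg (Real.rpow_nonneg (integral_nonneg hf0) _)
    (Real.rpow_nonneg (integral_nonneg hg0) _))).mp h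

/-- A zero-free holomorphic function on a disk has a holomorphic logarithm. -/
theorem exists_holomorphic_log {G : ℂ → ℂ} {R : ℝ} (hR : 0 < R)
    (hG : DifferentiableOn ℂ G (Metric.ball 0 R)) (h0 : ∀ z ∈ Metric.ball 0 R, G z ≠ 0) :
    ∃ ℓ : ℂ → ℂ, ∀ z ∈ Metric.ball 0 R,
      HasDerivAt ℓ (deriv G z / G z) z ∧ Complex.exp (ℓ z) = G z := by
  have hd : DifferentiableOn ℂ (fun z => deriv G z / G z) (Metric.ball 0 R) :=
    (hG.deriv Metric.isOpen_ball).div hG h0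
  obtain ⟨ℓ, hl0, hl⟩ := hd.isExactOn_ball.with_val_at 0 (Complex.log (G 0))
  refine ⟨ℓ, fun z hz => ⟨hl z hz, ?_⟩⟩
  have hc0 : (0 : ℂ) ∈ Metric.ball (0 : ℂ) R := Metric.mem_ball_self hR
  have hderiv : ∀ w ∈ Metric.ball (0 : ℂ) R,
      HasDerivAt (fun z => G z * Complex.exp (-ℓ z)) 0 w := by
    intro w hw
    have h1 := (hG.differentiableAt (Metric.isOpen_ball.mem_nhds hw)).hasDerivAt
    have h2 := h1.mul (hl w hw).neg.cexp
    have h3 : deriv G w * Complex.exp (-ℓ w)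
        + G w * (Complex.exp (-ℓ w) * -(deriv G w / G w)) = 0 := by
      have := h0 w hw
      field_simp
      ring
    exact h2.congr_deriv h3
  have key := Metric.isOpen_ball.is_const_of_deriv_eq_zero
    (convex_ball (0 : ℂ) R).isPreconnected
    (fun w hw => (hderiv w hw).differentiableAt.differentiableWithinAt)
    (fun w hw => (hderiv w hw).deriv) hz hc0
  simp only [hl0] at key
  rw [Complex.exp_neg, Complex.exp_neg, Complex.exp_log (h0 0 hc0),
    mul_inv_cancel₀ (h0 0 hc0)] at key
  exact ((mul_inv_eq_one₀ (Complex.exp_ne_zero _)).mp key).symm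

/-- The weights `9⁻ᵏ j²`, `j < 3ᵏ`, add up over `k` to at most `9/8` for each `j`. -/
theorem sum_triadic_weights_le {c : ℕ → ℝ} (hc : ∀ j, 0 ≤ c j) (K : ℕ) :
    ∑ k ∈ Finset.range K, (9 ^ k)⁻¹ * ∑ j ∈ Finset.range (3 ^ k), (j : ℝ) ^ 2 * c j
      ≤ 9 / 8 * ∑ j ∈ Finset.range (3 ^ K), c j := by
  set T : ℕ → ℝ := fun k => (9 ^ k)⁻¹ * ∑ j ∈ Finset.range (3 ^ k), (j : ℝ) ^ 2 * c j with hT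
  have hT0 : ∀ k, 0 ≤ T k := fun k =>
    mul_nonneg (by positivity) (Finset.sum_nonneg fun j _ => mul_nonneg (by positivity) (hc j))
  have hstep : ∀ k, T (k + 1) ≤ T k / 9 + ∑ j ∈ Finset.Ico ((3 : ℕ) ^ k) (3 ^ (k + 1)), c j := by
    intro k
    have hle : 3 ^ k ≤ 3 ^ (k + 1) := Nat.pow_le_pow_right (by norm_num) (by omega)
    have h1 : ∑ j ∈ Finset.Ico ((3 : ℕ) ^ k) (3 ^ (k + 1)), (j : ℝ) ^ 2 * c j
        ≤ 9 ^ (k + 1) * ∑ j ∈ Finset.Ico ((3 : ℕ) ^ k) (3 ^ (k + 1)), c j := by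
      rw [Finset.mul_sum]
      refine Finset.sum_le_sum fun j hj => mul_le_mul_of_nonneg_right ?_ (hc j)
      have h2 : (j : ℝ) ≤ 3 ^ (k + 1) := by exact_mod_cast (Finset.mem_Ico.mp hj).2.le
      calc (j : ℝ) ^ 2 ≤ (3 ^ (k + 1)) ^ 2 := by gcongr
        _ = 9 ^ (k + 1) := by rw [← pow_mul, mul_comm, pow_mul]; norm_num
    simp only [hT]
    rw [← Finset.sum_range_add_sum_Ico _ hle, mul_add]
    refine add_le_add (le_of_eq ?_) ?_
    · rw [pow_succ, mul_inv]; ring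
    · calc _ ≤ ((9 : ℝ) ^ (k + 1))⁻¹ * (9 ^ (k + 1)
            * ∑ j ∈ Finset.Ico ((3 : ℕ) ^ k) (3 ^ (k + 1)), c j) := by gcongr
        _ = _ := by rw [← mul_assoc, inv_mul_cancel₀ (by positivity), one_mul]
  -- the extra term makes the induction on `K` close
  have key : ∑ k ∈ Finset.range K, T k + 9 / 8 * T K ≤ 9 / 8 * ∑ j ∈ Finset.range (3 ^ K), c j := by
    induction K with
    | zero => simpa [hT] using hc 0
    | succ K ih =>
      have hle : 3 ^ K ≤ 3 ^ (K + 1) := Nat.pow_le_pow_right (by norm_num) (by omega)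
      rw [Finset.sum_range_succ, ← Finset.sum_range_add_sum_Ico _ hle]
      linarith [hstep K]
  linarith [hT0 K]

/-- The estimate over `3ᵏ - 3ˡ` for a function without zeros. With `φ = G^{p/2}` and
`h = G^{1-p/2}` one has `z G' = (2/p) h · z φ'`, and only the part of `z φ'` with frequencies below
`3ᵏ` contributes to the coefficients of frequency below `3ᵏ`. -/
theorem sum_sq_norm_coeff_le_of_ne_zero {p q : ℝ} (hpq : p.HolderConjugate q) (hp : p ≤ 2)
    {G : ℂ → ℂ} {R : ℝ} (hR : 1 < R) (hG : DifferentiableOn ℂ G (Metric.ball 0 R))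
    (h0 : ∀ z ∈ Metric.ball 0 R, G z ≠ 0) {a : ℕ → ℂ}
    (ha : IsAnalyticSeries (fun x : UnitAddCircle => G (fourier 1 x)) a) (K : ℕ) :
    ∑ k ∈ Finset.range K, ∑ l ∈ Finset.range k, ‖a (3 ^ k - 3 ^ l)‖ ^ 2
      ≤ 81 / 8 * Real.exp 4 * q
        * (∫ x : UnitAddCircle, ‖G (fourier 1 x)‖ ^ p ∂AddCircle.haarAddCircle) ^ (2 / p) := by
  have hp1 : 1 < p := hpq.lt
  have hp0 : 0 < p := by linarith
  have hq2 : 2 ≤ q := by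
    have h1 := hpq.inv_add_inv_eq_one
    have h2 : (2 : ℝ)⁻¹ ≤ p⁻¹ := inv_anti₀ hp0 hp
    have h3 : q⁻¹ ≤ (2 : ℝ)⁻¹ := by linarith
    exact (inv_le_inv₀ hpq.symm.pos (by norm_num)).mp h3
  obtain ⟨ℓ, hl⟩ := exists_holomorphic_log (by linarith) hG h0
  have hball : ∀ x : UnitAddCircle, (fourier 1 x : ℂ) ∈ Metric.ball (0 : ℂ) R := by
    intro x
    rw [mem_ball_zero_iff, norm_fourier_apply]
    exact hR
  have hld : DifferentiableOn ℂ ℓ (Metric.ball 0 R) := fun z hz =>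
    (hl z hz).1.differentiableAt.differentiableWithinAt
  set φ : ℂ → ℂ := fun z => Complex.exp ((p / 2 : ℝ) * ℓ z) with hφ
  set h : ℂ → ℂ := fun z => Complex.exp ((1 - p / 2 : ℝ) * ℓ z) with hh
  have hnorm : ∀ (s : ℝ), ∀ z ∈ Metric.ball (0 : ℂ) R, ‖Complex.exp (s * ℓ z)‖ = ‖G z‖ ^ s := by
    intro s z hz
    rw [← (hl z hz).2, Complex.norm_exp, Complex.norm_exp, Complex.re_ofReal_mul, ← Real.exp_mul,
      mul_comm]
  obtain ⟨b, hb, hb'⟩ := IsAnalyticSeries.exists_of_differentiableOn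
    (show DifferentiableOn ℂ φ (Metric.ball 0 R) from (hld.const_mul _).cexp) hR
  obtain ⟨d, hd, -⟩ := IsAnalyticSeries.exists_of_differentiableOn
    (show DifferentiableOn ℂ h (Metric.ball 0 R) from (hld.const_mul _).cexp) hR
  obtain ⟨a', ha', ha''⟩ := IsAnalyticSeries.exists_of_differentiableOn hG hR
  obtain rfl : a' = a := ha'.coeff_unique ha
  set A := ∫ x, ‖G (fourier 1 x)‖ ^ p ∂(AddCircle.haarAddCircle : Measure UnitAddCircle) with hA
  have hA0 : 0 ≤ A := integral_nonneg fun _ => by positivity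
  -- the coefficients of `z G'` as a convolution
  have hconv : ∀ n : ℕ, (n : ℂ) * a' n = (2 / p : ℝ) *
      ∑ ij ∈ Finset.HasAntidiagonal.antidiagonal n, d ij.1 * (ij.2 * b ij.2) := by
    have h1 := (hd.mul hb').const_mul (2 / p : ℝ)
    have h2 : (fun x : UnitAddCircle => ((2 / p : ℝ) : ℂ) *
        (h (fourier 1 x) * (fourier 1 x * deriv φ (fourier 1 x))))
        = fun x => fourier 1 x * deriv G (fourier 1 x) := by
      ext x
      set z : ℂ := fourier 1 x with hz
      obtain ⟨h3, h4⟩ := hl z (hball x)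
      have h5 : deriv φ z = φ z * ((p / 2 : ℝ) * (deriv G z / G z)) :=
        (h3.const_mul _).cexp.deriv
      have h6 : h z * φ z = G z := by
        rw [hφ, hh, ← h4]
        simp only
        rw [← Complex.exp_add]
        congr 1
        push_cast
        ring
      have h7 : G z ≠ 0 := h0 z (hball x)
      have hp' : (p : ℂ) ≠ 0 := by exact_mod_cast hp0.ne'
      calc _ = ((2 / p : ℝ) : ℂ) * ((h z * φ z) * (z * ((p / 2 : ℝ) * (deriv G z / G z)))) := by
            rw [h5]; ring
        _ = z * deriv G z := by
            rw [h6]; push_cast; field_simp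
    rw [h2] at h1
    intro n
    exact congrFun (ha''.coeff_unique h1) n
  set ψ : ℕ → UnitAddCircle → ℂ := fun k x =>
    ∑ j ∈ Finset.range (3 ^ k), ((j : ℂ) * b j) * fourier (j : ℤ) x with hψ
  have hψs : ∀ k, IsAnalyticSeries (ψ k) (fun j => if j < 3 ^ k then (j : ℂ) * b j else 0) :=
    fun k => IsAnalyticSeries.of_sum_range _ _
  have hψsq : ∀ k, ∫ x, ‖ψ k x‖ ^ 2 ∂(AddCircle.haarAddCircle : Measure UnitAddCircle)
      = ∑ j ∈ Finset.range (3 ^ k), (j : ℝ) ^ 2 * ‖b j‖ ^ 2 := by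
    intro k
    refine (hψs k).hasSum_sq_norm.unique ?_
    have : ∑ j ∈ Finset.range (3 ^ k), (j : ℝ) ^ 2 * ‖b j‖ ^ 2
        = ∑ j ∈ Finset.range (3 ^ k), ‖if j < 3 ^ k then (j : ℂ) * b j else 0‖ ^ 2 := by
      refine Finset.sum_congr rfl fun j hj => ?_
      rw [if_pos (Finset.mem_range.mp hj), norm_mul, mul_pow, Complex.norm_natCast]
    rw [this]
    refine hasSum_sum_of_ne_finset_zero fun j hj => ?_
    rw [if_neg (by simpa using hj)]
    simp
  have hcoeff : ∀ k l : ℕ, l < k → ((3 ^ k - 3 ^ l : ℕ) : ℂ) * a' (3 ^ k - 3 ^ l) = (2 / p : ℝ) *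
      fourierCoeff (fun x => h (fourier 1 x) * ψ k x) (3 ^ k - 3 ^ l) := by
    intro k l hlk
    have hlt : 3 ^ l < 3 ^ k := Nat.pow_lt_pow_right (by norm_num) hlk
    have hpos : 0 < 3 ^ l := by positivity
    have hcast : ((3 : ℤ) ^ k - 3 ^ l) = ((3 ^ k - 3 ^ l : ℕ) : ℤ) := by
      rw [Nat.cast_sub hlt.le]; push_cast; rfl
    rw [hcast, (hd.mul (hψs k)).fourierCoeff_natCast, hconv]
    congr 1
    refine Finset.sum_congr rfl fun ij hij => ?_
    have := Finset.HasAntidiagonal.mem_antidiagonal.mp hij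
    rw [if_pos (by omega)]
  have hest : ∀ k l : ℕ, l < k → ‖a' (3 ^ k - 3 ^ l)‖ ^ 2 ≤ 9 * (9 ^ k)⁻¹ *
      ‖fourierCoeff (fun x => h (fourier 1 x) * ψ k x) (3 ^ k - 3 ^ l)‖ ^ 2 := by
    intro k l hlk
    have h1 := congrArg norm (hcoeff k l hlk)
    have hlt : 3 ^ l < 3 ^ k := Nat.pow_lt_pow_right (by norm_num) hlk
    rw [norm_mul, norm_mul, Complex.norm_natCast, Complex.norm_real,
      Real.norm_of_nonneg (by positivity), Nat.cast_sub hlt.le] at h1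
    push_cast at h1
    set y := ‖a' (3 ^ k - 3 ^ l)‖ with hy
    set w := ‖fourierCoeff (fun x => h (fourier 1 x) * ψ k x) (3 ^ k - 3 ^ l)‖ with hw
    have h2 : (3 : ℝ) * 3 ^ l ≤ 3 ^ k := by
      rw [← pow_succ']
      exact pow_le_pow_right₀ (by norm_num) hlk
    have h3 : 2 / p ≤ 2 := by
      rw [div_le_iff₀ hp0]; linarith
    have hy0 : 0 ≤ y := norm_nonneg _
    have hw0 : 0 ≤ w := norm_nonneg _
    have h4 : 2 / 3 * 3 ^ k * y ≤ 2 * w := by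
      calc 2 / 3 * 3 ^ k * y ≤ (3 ^ k - 3 ^ l) * y := by
            refine mul_le_mul_of_nonneg_right ?_ hy0
            linarith
        _ = 2 / p * w := h1
        _ ≤ 2 * w := by gcongr
    have h5 : 3 ^ k * y ≤ 3 * w := by linarith
    have h6 : (3 ^ k * y) ^ 2 ≤ (3 * w) ^ 2 := by gcongr
    have h7 : ((3 : ℝ) ^ k) ^ 2 = 9 ^ k := by rw [← pow_mul, mul_comm, pow_mul]; norm_num
    rw [mul_pow, mul_pow, h7] at h6
    have h9 : (0 : ℝ) < 9 ^ k := by positivity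
    calc y ^ 2 = (9 ^ k)⁻¹ * (9 ^ k * y ^ 2) := by field_simp
      _ ≤ (9 ^ k)⁻¹ * (3 ^ 2 * w ^ 2) := by gcongr
      _ = _ := by ring
  have hGc : Continuous fun x : UnitAddCircle => ‖G (fourier 1 x)‖ ^ p :=
    ha.continuous.norm.rpow_const fun _ => Or.inr hp0.le
  have hholder : ∀ k, (∫ x, ‖h (fourier 1 x) * ψ k x‖ ^ p
      ∂(AddCircle.haarAddCircle : Measure UnitAddCircle)) ^ (2 / p)
      ≤ A ^ ((2 - p) / p) * ∑ j ∈ Finset.range (3 ^ k), (j : ℝ) ^ 2 * ‖b j‖ ^ 2 := by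
    intro k
    rw [← hψsq]
    set B := ∫ x, ‖ψ k x‖ ^ 2 ∂(AddCircle.haarAddCircle : Measure UnitAddCircle) with hB
    have hB0 : 0 ≤ B := integral_nonneg fun _ => by positivity
    have h1 := integral_rpow_mul_rpow_le (f := fun x => ‖G (fourier 1 x)‖ ^ p)
      (g := fun x => ‖ψ k x‖ ^ 2) hGc ((hψs k).continuous.norm.pow 2)
      (fun _ => by positivity) (fun _ => by positivity) (s := 1 - p / 2) (t := p / 2)
      (by linarith) (by positivity) (by ring)
    have h2 : ∀ x : UnitAddCircle, (‖G (fourier 1 x)‖ ^ p) ^ (1 - p / 2)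
        * (‖ψ k x‖ ^ 2) ^ (p / 2) = ‖h (fourier 1 x) * ψ k x‖ ^ p := by
      intro x
      have h3 : ‖h (fourier 1 x)‖ = ‖G (fourier 1 x)‖ ^ (1 - p / 2) := hnorm _ _ (hball x)
      rw [norm_mul, Real.mul_rpow (norm_nonneg _) (norm_nonneg _), h3,
        ← Real.rpow_mul (norm_nonneg _), ← Real.rpow_mul (norm_nonneg _), ← Real.rpow_natCast,
        ← Real.rpow_mul (norm_nonneg _)]
      congr 2
      · ring
      · push_cast; ring
    simp_rw [h2] at h1
    calc _ ≤ (A ^ (1 - p / 2) * B ^ (p / 2)) ^ (2 / p) :=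
          Real.rpow_le_rpow (integral_nonneg fun _ => by positivity) h1 (by positivity)
      _ = A ^ ((2 - p) / p) * B := by
          rw [Real.mul_rpow (by positivity) (by positivity), ← Real.rpow_mul hA0,
            ← Real.rpow_mul hB0, show p / 2 * (2 / p) = 1 by field_simp, Real.rpow_one]
          congr 2
          field_simp
  have hhc : Continuous fun x : UnitAddCircle => h (fourier 1 x) := hd.continuous
  have hbessel : ∑ j ∈ Finset.range (3 ^ K), ‖b j‖ ^ 2 ≤ A := by
    refine (sum_le_hasSum _ (fun _ _ => by positivity) hb.hasSum_sq_norm).trans (le_of_eq ?_)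
    refine integral_congr_ae (Eventually.of_forall fun x => ?_)
    have h3 : ‖φ (fourier 1 x)‖ = ‖G (fourier 1 x)‖ ^ (p / 2) := hnorm _ _ (hball x)
    dsimp only
    rw [h3, ← Real.rpow_natCast, ← Real.rpow_mul (norm_nonneg _)]
    congr 1
    push_cast
    ring
  have hq0 : 0 ≤ q := by linarith
  calc ∑ k ∈ Finset.range K, ∑ l ∈ Finset.range k, ‖a' (3 ^ k - 3 ^ l)‖ ^ 2
      ≤ ∑ k ∈ Finset.range K, 9 * Real.exp 4 * q * A ^ ((2 - p) / p) *
        ((9 ^ k)⁻¹ * ∑ j ∈ Finset.range (3 ^ k), (j : ℝ) ^ 2 * ‖b j‖ ^ 2) := by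
        refine Finset.sum_le_sum fun k _ => ?_
        have h1 := sum_sq_norm_fourierCoeff_sub_three_pow_le hpq hq2
          (hhc.mul (hψs k).continuous) (3 ^ k) k
        calc _ ≤ ∑ l ∈ Finset.range k, 9 * (9 ^ k)⁻¹ *
              ‖fourierCoeff (fun x => h (fourier 1 x) * ψ k x) (3 ^ k - 3 ^ l)‖ ^ 2 :=
              Finset.sum_le_sum fun l hl => hest k l (Finset.mem_range.mp hl)
          _ ≤ 9 * (9 ^ k)⁻¹ * (Real.exp 4 * q *
              (A ^ ((2 - p) / p) * ∑ j ∈ Finset.range (3 ^ k), (j : ℝ) ^ 2 * ‖b j‖ ^ 2)) := by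
              rw [← Finset.mul_sum]
              refine mul_le_mul_of_nonneg_left (h1.trans ?_) (by positivity)
              exact mul_le_mul_of_nonneg_left (hholder k) (by positivity)
          _ = _ := by ring
    _ ≤ 9 * Real.exp 4 * q * A ^ ((2 - p) / p) * (9 / 8 * A) := by
        rw [← Finset.mul_sum]
        refine mul_le_mul_of_nonneg_left ?_ (by positivity)
        refine (sum_triadic_weights_le (fun j => by positivity) K).trans ?_
        exact mul_le_mul_of_nonneg_left hbessel (by norm_num)
    _ = 81 / 8 * Real.exp 4 * q * (A ^ ((2 - p) / p) * A) := by ring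
    _ = _ := by
        congr 1
        rcases hA0.eq_or_lt with h1 | h1
        · rw [← h1, mul_zero, Real.zero_rpow (by positivity)]
        · nth_rewrite 2 [← Real.rpow_one A]
          rw [← Real.rpow_add h1]
          congr 1
          field_simp
          ring

/-! ### The estimate on the circle -/

/-- Zeros on the unit circle are allowed: the estimate is applied to `P (r z)` and `r → 1`. -/
theorem Polynomial.sum_sq_norm_coeff_le_of_ne_zero {p q : ℝ} (hpq : p.HolderConjugate q)
    (hp : p ≤ 2) {P : Polynomial ℂ} (h0 : ∀ z : ℂ, ‖z‖ < 1 → P.eval z ≠ 0) (K : ℕ) :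
    ∑ k ∈ Finset.range K, ∑ l ∈ Finset.range k, ‖P.coeff (3 ^ k - 3 ^ l)‖ ^ 2
      ≤ 81 / 8 * Real.exp 4 * q
        * (∫ x : UnitAddCircle, ‖P.eval (fourier 1 x)‖ ^ p ∂AddCircle.haarAddCircle) ^ (2 / p) := by
  have hp0 : 0 < p := hpq.pos
  have key : ∀ r : ℝ, r ∈ Set.Ioo (0 : ℝ) 1 →
      ∑ k ∈ Finset.range K, ∑ l ∈ Finset.range k, ‖P.coeff (3 ^ k - 3 ^ l)
        * (r : ℂ) ^ (3 ^ k - 3 ^ l)‖ ^ 2 ≤ 81 / 8 * Real.exp 4 * q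
        * (∫ x : UnitAddCircle, ‖P.eval ((r : ℂ) * fourier 1 x)‖ ^ p
          ∂AddCircle.haarAddCircle) ^ (2 / p) := by
    rintro r ⟨hr0, hr1⟩
    set Q := P.comp (Polynomial.C (r : ℂ) * Polynomial.X) with hQ
    have hev : ∀ z, Q.eval z = P.eval (r * z) := by
      intro z; simp [hQ]
    have h1 := _root_.sum_sq_norm_coeff_le_of_ne_zero hpq hp (G := fun z => Q.eval z)
      (one_lt_inv₀ hr0 |>.mpr hr1)
      Q.differentiable.differentiableOn (fun z hz => ?_)
      (IsAnalyticSeries.of_polynomial Q) K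
    · simp only [hev] at h1
      simp only [hQ, Polynomial.comp_C_mul_X_coeff] at h1
      exact h1
    · simp only [hev]
      apply h0
      rw [mem_ball_zero_iff] at hz
      rw [norm_mul, Complex.norm_real, Real.norm_of_nonneg hr0.le]
      calc r * ‖z‖ < r * r⁻¹ := by gcongr
        _ = 1 := mul_inv_cancel₀ hr0.ne'
  have hl : Tendsto (fun r : ℝ => ∑ k ∈ Finset.range K, ∑ l ∈ Finset.range k,
      ‖P.coeff (3 ^ k - 3 ^ l) * (r : ℂ) ^ (3 ^ k - 3 ^ l)‖ ^ 2) (𝓝[<] 1)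
      (𝓝 (∑ k ∈ Finset.range K, ∑ l ∈ Finset.range k, ‖P.coeff (3 ^ k - 3 ^ l)‖ ^ 2)) := by
    have hc : Continuous fun r : ℝ => ∑ k ∈ Finset.range K, ∑ l ∈ Finset.range k,
      ‖P.coeff (3 ^ k - 3 ^ l) * (r : ℂ) ^ (3 ^ k - 3 ^ l)‖ ^ 2 := by fun_prop
    have := (hc.tendsto 1).mono_left (nhdsWithin_le_nhds (s := Set.Iio 1))
    simpa using this
  have hr : Tendsto (fun r : ℝ => 81 / 8 * Real.exp 4 * q
        * (∫ x : UnitAddCircle, ‖P.eval ((r : ℂ) * fourier 1 x)‖ ^ p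
          ∂AddCircle.haarAddCircle) ^ (2 / p)) (𝓝[<] 1)
      (𝓝 (81 / 8 * Real.exp 4 * q
        * (∫ x : UnitAddCircle, ‖P.eval (fourier 1 x)‖ ^ p
          ∂AddCircle.haarAddCircle) ^ (2 / p))) := by
    have hc2 : Continuous (Function.uncurry fun (r : ℝ) (x : UnitAddCircle) =>
        ‖P.eval ((r : ℂ) * fourier 1 x)‖ ^ p) := by
      refine Continuous.rpow_const ?_ fun _ => Or.inr hp0.le
      exact (P.continuous.comp (by fun_prop)).norm
    have hc : Continuous fun r : ℝ => ∫ x : UnitAddCircle, ‖P.eval ((r : ℂ) * fourier 1 x)‖ ^ p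
          ∂AddCircle.haarAddCircle := by
      have := continuous_parametric_integral_of_continuous
        (μ := (AddCircle.haarAddCircle : Measure UnitAddCircle)) hc2
        (isCompact_univ)
      simpa using this
    have hc3 := (hc.rpow_const fun _ => Or.inr (show 0 ≤ 2 / p by positivity)).const_mul
      (81 / 8 * Real.exp 4 * q)
    have := (hc3.tendsto 1).mono_left (nhdsWithin_le_nhds (s := Set.Iio 1))
    simpa using this
  refine le_of_tendsto_of_tendsto hl hr ?_
  filter_upwards [Ioo_mem_nhdsLT (show (0 : ℝ) < 1 by norm_num)] with r hr
  exact key r hr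

/-- Reflecting the zeros `a` with `‖a‖ < 1` in the unit circle, `z - a ↦ 1 - conj a * z`, gives a
polynomial without zeros in the disk that dominates the given one and has the same modulus on the
circle. -/
theorem Polynomial.exists_zeroFree_majorant {f : Polynomial ℂ} (hf : f ≠ 0) :
    ∃ F : Polynomial ℂ, (∀ z : ℂ, ‖z‖ < 1 → F.eval z ≠ 0) ∧
      (∀ z : ℂ, ‖z‖ ≤ 1 → ‖f.eval z‖ ≤ ‖F.eval z‖) ∧
      (∀ z : ℂ, ‖z‖ = 1 → ‖F.eval z‖ = ‖f.eval z‖) := by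
  set Q : Polynomial ℂ → Prop := fun f => ∃ F : Polynomial ℂ, (∀ z : ℂ, ‖z‖ < 1 → F.eval z ≠ 0) ∧
      (∀ z : ℂ, ‖z‖ ≤ 1 → ‖f.eval z‖ ≤ ‖F.eval z‖) ∧
      (∀ z : ℂ, ‖z‖ = 1 → ‖F.eval z‖ = ‖f.eval z‖) with hQ
  have hmul : ∀ f g, Q f → Q g → Q (f * g) := by
    rintro f g ⟨F, hF1, hF2, hF3⟩ ⟨G, hG1, hG2, hG3⟩
    refine ⟨F * G, fun z hz => ?_, fun z hz => ?_, fun z hz => ?_⟩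
    · rw [Polynomial.eval_mul]
      exact mul_ne_zero (hF1 z hz) (hG1 z hz)
    · rw [Polynomial.eval_mul, Polynomial.eval_mul, norm_mul, norm_mul]
      exact mul_le_mul (hF2 z hz) (hG2 z hz) (norm_nonneg _) (norm_nonneg _)
    · rw [Polynomial.eval_mul, Polynomial.eval_mul, norm_mul, norm_mul, hF3 z hz, hG3 z hz]
  have hC : ∀ c : ℂ, c ≠ 0 → Q (Polynomial.C c) := fun c hc =>
    ⟨Polynomial.C c, fun z _ => by simpa using hc, fun _ _ => le_rfl, fun _ _ => rfl⟩
  have hX : ∀ a : ℂ, Q (Polynomial.X - Polynomial.C a) := by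
    intro a
    have hid : ∀ z : ℂ, ‖1 - (starRingEnd ℂ) a * z‖ ^ 2
        = ‖z - a‖ ^ 2 + (1 - ‖a‖ ^ 2) * (1 - ‖z‖ ^ 2) := by
      intro z
      simp only [← Complex.normSq_eq_norm_sq, Complex.normSq_apply, Complex.sub_re,
        Complex.sub_im, Complex.mul_re, Complex.mul_im, Complex.conj_re, Complex.conj_im,
        Complex.one_re, Complex.one_im]
      ring
    rcases lt_or_ge ‖a‖ 1 with ha | ha
    · have ha2 : 0 ≤ 1 - ‖a‖ ^ 2 := by nlinarith [norm_nonneg a]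
      refine ⟨1 - Polynomial.C ((starRingEnd ℂ) a) * Polynomial.X, fun z hz h => ?_,
        fun z hz => ?_, fun z hz => ?_⟩
      · simp only [Polynomial.eval_sub, Polynomial.eval_one, Polynomial.eval_mul,
          Polynomial.eval_C, Polynomial.eval_X] at h
        have h1 : ‖(starRingEnd ℂ) a * z‖ = 1 := by rw [← sub_eq_zero.mp h, norm_one]
        rw [norm_mul, RCLike.norm_conj] at h1
        nlinarith [norm_nonneg a, norm_nonneg z]
      · simp only [Polynomial.eval_sub, Polynomial.eval_one, Polynomial.eval_mul,
          Polynomial.eval_C, Polynomial.eval_X]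
        refine le_of_sq_le_sq ?_ (norm_nonneg _)
        rw [hid]
        have : 0 ≤ 1 - ‖z‖ ^ 2 := by nlinarith [norm_nonneg z]
        nlinarith [mul_nonneg ha2 this]
      · simp only [Polynomial.eval_sub, Polynomial.eval_one, Polynomial.eval_mul,
          Polynomial.eval_C, Polynomial.eval_X]
        rw [← sq_eq_sq₀ (norm_nonneg _) (norm_nonneg _), hid, hz]
        ring
    · refine ⟨Polynomial.X - Polynomial.C a, fun z hz h => ?_, fun _ _ => le_rfl, fun _ _ => rfl⟩
      simp only [Polynomial.eval_sub, Polynomial.eval_C, Polynomial.eval_X] at h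
      rw [sub_eq_zero.mp h] at hz
      linarith
  have hone : Q 1 := by simpa using hC 1 one_ne_zero
  change Q f
  rw [(IsAlgClosed.splits f).eq_prod_roots]
  refine hmul _ _ (hC _ (Polynomial.leadingCoeff_ne_zero.mpr hf)) ?_
  refine Multiset.prod_induction Q _ (fun a b => hmul a b) hone ?_
  intro g hg
  obtain ⟨a, -, rfl⟩ := Multiset.mem_map.mp hg
  exact hX a

theorem Polynomial.sum_sq_norm_coeff_le {p q : ℝ} (hpq : p.HolderConjugate q)
    (hp : p ≤ 2) (f : Polynomial ℂ) (K : ℕ) :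
    ∑ k ∈ Finset.range K, ∑ l ∈ Finset.range k, ‖f.coeff (3 ^ k - 3 ^ l)‖ ^ 2
      ≤ 1053 / 4 * Real.exp 4 * q
        * (∫ x : UnitAddCircle, ‖f.eval (fourier 1 x)‖ ^ p ∂AddCircle.haarAddCircle) ^ (2 / p) := by
  have hp0 : 0 < p := hpq.pos
  have hq0 : 0 < q := hpq.symm.pos
  rcases eq_or_ne f 0 with rfl | hf
  · simp only [Polynomial.coeff_zero, norm_zero]
    rw [Finset.sum_eq_zero fun _ _ => Finset.sum_eq_zero fun _ _ => by norm_num]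
    exact mul_nonneg (by positivity)
      (Real.rpow_nonneg (integral_nonneg fun _ => Real.rpow_nonneg (norm_nonneg _) _) _)
  obtain ⟨F, hF1, hF2, hF3⟩ := Polynomial.exists_zeroFree_majorant hf
  -- `f = (f + 2F) - 2F`, where neither summand vanishes in the disk
  set g := f + Polynomial.C 2 * F with hg
  have hge : ∀ z, g.eval z = f.eval z + 2 * F.eval z := by intro z; simp [hg]
  have hg1 : ∀ z : ℂ, ‖z‖ < 1 → g.eval z ≠ 0 := by
    intro z hz h
    rw [hge] at h
    have h1 := hF2 z hz.le
    have h2 : ‖f.eval z‖ = 2 * ‖F.eval z‖ := by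
      rw [eq_neg_of_add_eq_zero_left h, norm_neg, norm_mul]; simp
    have h3 : 0 < ‖F.eval z‖ := norm_pos_iff.mpr (hF1 z hz)
    linarith
  have e1 := Polynomial.sum_sq_norm_coeff_le_of_ne_zero hpq hp hg1 K
  have e2 := Polynomial.sum_sq_norm_coeff_le_of_ne_zero hpq hp hF1 K
  set A := ∫ x : UnitAddCircle, ‖f.eval (fourier 1 x)‖ ^ p ∂AddCircle.haarAddCircle with hA
  have hA0 : 0 ≤ A := integral_nonneg fun _ => by positivity
  have hFA : ∫ x : UnitAddCircle, ‖F.eval (fourier 1 x)‖ ^ p ∂AddCircle.haarAddCircle = A :=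
    integral_congr_ae (Eventually.of_forall fun x => by
      dsimp only; rw [hF3 _ (norm_fourier_apply 1 x)])
  have hgA : (∫ x : UnitAddCircle, ‖g.eval (fourier 1 x)‖ ^ p ∂AddCircle.haarAddCircle) ^ (2 / p)
      ≤ 9 * A ^ (2 / p) := by
    have h1 : ∫ x : UnitAddCircle, ‖g.eval (fourier 1 x)‖ ^ p ∂AddCircle.haarAddCircle
        ≤ 3 ^ p * A := by
      rw [hA, ← integral_const_mul]
      have hcont : ∀ P : Polynomial ℂ, Continuous fun x : UnitAddCircle =>
          ‖P.eval (fourier 1 x)‖ ^ p := fun P =>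
        (IsAnalyticSeries.of_polynomial P).continuous.norm.rpow_const fun _ => Or.inr hp0.le
      refine integral_mono (hcont g).integrable_haarAddCircle
        ((hcont f).const_mul _).integrable_haarAddCircle fun x => ?_
      dsimp only
      rw [← Real.mul_rpow (by norm_num) (norm_nonneg _)]
      refine Real.rpow_le_rpow (norm_nonneg _) ?_ hp0.le
      rw [hge]
      refine (norm_add_le _ _).trans ?_
      rw [norm_mul, hF3 _ (norm_fourier_apply 1 x)]
      norm_num
      linarith
    calc _ ≤ (3 ^ p * A) ^ (2 / p) :=
          Real.rpow_le_rpow (integral_nonneg fun _ => by positivity) h1 (by positivity)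
      _ = 9 * A ^ (2 / p) := by
          rw [Real.mul_rpow (by positivity) hA0, ← Real.rpow_mul (by norm_num),
            show p * (2 / p) = (2 : ℕ) by push_cast; field_simp, Real.rpow_natCast]
          norm_num
  rw [hFA] at e2
  have hM : 0 ≤ 81 / 8 * Real.exp 4 * q := by positivity
  have e1' := e1.trans (mul_le_mul_of_nonneg_left hgA hM)
  have hsum : ∑ k ∈ Finset.range K, ∑ l ∈ Finset.range k, ‖f.coeff (3 ^ k - 3 ^ l)‖ ^ 2
      ≤ 2 * (∑ k ∈ Finset.range K, ∑ l ∈ Finset.range k, ‖g.coeff (3 ^ k - 3 ^ l)‖ ^ 2)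
        + 8 * ∑ k ∈ Finset.range K, ∑ l ∈ Finset.range k, ‖F.coeff (3 ^ k - 3 ^ l)‖ ^ 2 := by
    simp only [Finset.mul_sum, ← Finset.sum_add_distrib]
    refine Finset.sum_le_sum fun k _ => Finset.sum_le_sum fun l _ => ?_
    set n := 3 ^ k - 3 ^ l
    have h1 : f.coeff n = g.coeff n - 2 * F.coeff n := by simp [hg]
    have h2 : ‖f.coeff n‖ ≤ ‖g.coeff n‖ + 2 * ‖F.coeff n‖ := by
      rw [h1]
      refine (norm_sub_le _ _).trans ?_
      rw [norm_mul]
      norm_num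
    nlinarith [norm_nonneg (f.coeff n), norm_nonneg (g.coeff n), norm_nonneg (F.coeff n),
      sq_nonneg (‖g.coeff n‖ - 2 * ‖F.coeff n‖)]
  linarith

/-- The polynomial estimate passes to absolutely convergent series through their partial sums. -/
theorem IsAnalyticSeries.sum_sq_norm_coeff_le {p q : ℝ} (hpq : p.HolderConjugate q)
    (hp : p ≤ 2) {f : UnitAddCircle → ℂ} {a : ℕ → ℂ} (h : IsAnalyticSeries f a) (K : ℕ) :
    ∑ k ∈ Finset.range K, ∑ l ∈ Finset.range k, ‖a (3 ^ k - 3 ^ l)‖ ^ 2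
      ≤ 1053 / 4 * Real.exp 4 * q
        * (∫ x, ‖f x‖ ^ p ∂AddCircle.haarAddCircle) ^ (2 / p) := by
  have hp0 : 0 < p := hpq.pos
  set P : ℕ → Polynomial ℂ := fun N =>
    ∑ n ∈ Finset.range N, Polynomial.C (a n) * Polynomial.X ^ n with hP
  have hPc : ∀ N n, n < N → (P N).coeff n = a n := by
    intro N n hn
    simp only [hP, Polynomial.finsetSum_coeff, Polynomial.coeff_C_mul_X_pow]
    rw [Finset.sum_ite_eq, if_pos (Finset.mem_range.mpr hn)]
  have hPe : ∀ N (x : UnitAddCircle), (P N).eval (fourier 1 x)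
      = ∑ n ∈ Finset.range N, a n * fourier (n : ℤ) x := by
    intro N x
    simp only [hP, Polynomial.eval_finsetSum, fourier_natCast_apply]
    simp
  have hlim : Tendsto (fun N => ∫ x : UnitAddCircle, ‖(P N).eval (fourier 1 x)‖ ^ p
      ∂AddCircle.haarAddCircle) atTop (𝓝 (∫ x, ‖f x‖ ^ p ∂AddCircle.haarAddCircle)) := by
    refine tendsto_integral_of_dominated_convergence (fun _ => (∑' n, ‖a n‖) ^ p) (fun N => ?_)
      (integrable_const _) (fun N => Eventually.of_forall fun x => ?_)
      (Eventually.of_forall fun x => ?_)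
    · exact ((IsAnalyticSeries.of_polynomial (P N)).continuous.norm.rpow_const
        fun _ => Or.inr hp0.le).aestronglyMeasurable
    · rw [Real.norm_of_nonneg (by positivity)]
      refine Real.rpow_le_rpow (norm_nonneg _) ?_ hp0.le
      rw [hPe]
      refine (norm_sum_le _ _).trans ?_
      simp_rw [IsAnalyticSeries.norm_term]
      exact h.1.sum_le_tsum _ fun _ _ => norm_nonneg _
    · simp_rw [hPe]
      exact (h.2 x).tendsto_sum_nat.norm.rpow_const (Or.inr hp0.le)
  have hlim2 := (hlim.rpow_const (p := 2 / p) (Or.inr (by positivity))).const_mul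
    (1053 / 4 * Real.exp 4 * q)
  refine ge_of_tendsto hlim2 ?_
  filter_upwards [eventually_ge_atTop (3 ^ K)] with N hN
  refine le_trans (le_of_eq ?_) (Polynomial.sum_sq_norm_coeff_le hpq hp (P N) K)
  refine Finset.sum_congr rfl fun k hk => Finset.sum_congr rfl fun l _ => ?_
  rw [hPc]
  have h1 : 3 ^ k < 3 ^ K := Nat.pow_lt_pow_right (by norm_num) (Finset.mem_range.mp hk)
  exact ((Nat.sub_le _ _).trans_lt h1).trans_le hN

/-- The estimate in one variable, with the constant `O(1 / (p - 1))` for the squares. -/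
theorem IsAnalyticSeries.sum_sq_norm_fourierCoeff_le {p : ℝ} (hp1 : 1 < p) (hp : p ≤ 2)
    {f : UnitAddCircle → ℂ} {a : ℕ → ℂ} (h : IsAnalyticSeries f a) {S : Finset ℤ}
    (hS : ∀ m ∈ S, m ∈ meyerSet) :
    ∑ m ∈ S, ‖fourierCoeff f m‖ ^ 2
      ≤ 1053 / 2 * Real.exp 4 / (p - 1)
        * (∫ x, ‖f x‖ ^ p ∂AddCircle.haarAddCircle) ^ (2 / p) := by
  have hpq := Real.HolderConjugate.conjExponent hp1
  choose! k l hlk hkl using hS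
  set K := S.sup k + 1 with hK
  have hinj : Set.InjOn (fun m => (⟨k m, l m⟩ : (_ : ℕ) × ℕ)) S := by
    intro m hm m' hm' he
    simp only [Sigma.mk.injEq, heq_eq_eq] at he
    rw [hkl m hm, hkl m' hm', he.1, he.2]
  have h1 : ∑ m ∈ S, ‖fourierCoeff f m‖ ^ 2
      ≤ ∑ k ∈ Finset.range K, ∑ l ∈ Finset.range k, ‖a (3 ^ k - 3 ^ l)‖ ^ 2 := by
    rw [Finset.sum_sigma']
    calc ∑ m ∈ S, ‖fourierCoeff f m‖ ^ 2 = ∑ m ∈ S, ‖a (3 ^ k m - 3 ^ l m)‖ ^ 2 := by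
          refine Finset.sum_congr rfl fun m hm => ?_
          have hlt : 3 ^ l m < 3 ^ k m := Nat.pow_lt_pow_right (by norm_num) (hlk m hm)
          rw [← h.fourierCoeff_natCast, Nat.cast_sub hlt.le]
          push_cast
          rw [← hkl m hm]
      _ = ∑ y ∈ S.image (fun m => (⟨k m, l m⟩ : (_ : ℕ) × ℕ)), ‖a (3 ^ y.1 - 3 ^ y.2)‖ ^ 2 :=
          (Finset.sum_image (f := fun y : (_ : ℕ) × ℕ => ‖a (3 ^ y.1 - 3 ^ y.2)‖ ^ 2) hinj).symm
      _ ≤ _ := by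
          refine Finset.sum_le_sum_of_subset_of_nonneg ?_ fun _ _ _ => by positivity
          intro y hy
          obtain ⟨m, hm, rfl⟩ := Finset.mem_image.mp hy
          simp only [Finset.mem_sigma, Finset.mem_range]
          exact ⟨Nat.lt_succ_of_le (Finset.le_sup hm), hlk m hm⟩
  refine h1.trans ((h.sum_sq_norm_coeff_le hpq hp K).trans ?_)
  refine mul_le_mul_of_nonneg_right ?_ (Real.rpow_nonneg (integral_nonneg fun _ => by positivity) _)
  have hpm : 0 < p - 1 := by linarith
  rw [Real.conjExponent, ← mul_div_assoc]
  refine div_le_div_of_nonneg_right ?_ hpm.le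
  nlinarith [Real.exp_pos 4]

/-! ### Iteration in two variables -/

/-- Minkowski's integral inequality `ℓ²(Lᵖ) ≤ Lᵖ(ℓ²)`, `p ≤ 2`: the norm of an integral is at most
the integral of the norm in `ℓ^{2/p}`. -/
theorem sum_integral_rpow_le {ι : Type*} [Fintype ι] {p : ℝ} (hp0 : 0 < p) (hp : p ≤ 2)
    {g : ι → UnitAddCircle → ℂ} (hg : ∀ i, Continuous (g i)) :
    ∑ i, (∫ x, ‖g i x‖ ^ p ∂AddCircle.haarAddCircle) ^ (2 / p)
      ≤ (∫ x, (∑ i, ‖g i x‖ ^ 2) ^ (p / 2) ∂AddCircle.haarAddCircle) ^ (2 / p) := by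
  set s : ℝ := 2 / p with hs
  have hs0 : 0 < s := by positivity
  have hs1 : 1 ≤ s := by rw [hs, le_div_iff₀ hp0]; linarith
  have : Fact (1 ≤ ENNReal.ofReal s) := ⟨by rw [← ENNReal.ofReal_one]; gcongr⟩
  have htr : (ENNReal.ofReal s).toReal = s := ENNReal.toReal_ofReal hs0.le
  set H : UnitAddCircle → PiLp (ENNReal.ofReal s) (fun _ : ι => ℝ) := fun x =>
    WithLp.toLp _ fun i => ‖g i x‖ ^ p with hH
  have hHc : Continuous H :=
    (PiLp.continuous_toLp _ _).comp (continuous_pi fun i =>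
      (hg i).norm.rpow_const fun _ => Or.inr hp0.le)
  have hcoord : ∀ i, (∫ x, H x ∂AddCircle.haarAddCircle) i
      = ∫ x, ‖g i x‖ ^ p ∂AddCircle.haarAddCircle := by
    intro i
    exact ((PiLp.proj (𝕜 := ℝ) (ENNReal.ofReal s) (fun _ : ι => ℝ) i).integral_comp_comm
      hHc.integrable_haarAddCircle).symm
  have key := norm_integral_le_integral_norm (μ := (AddCircle.haarAddCircle :
    Measure UnitAddCircle)) H
  have hn : ∀ x, ‖H x‖ = (∑ i, ‖g i x‖ ^ 2) ^ (p / 2) := by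
    intro x
    rw [PiLp.norm_eq_sum (by rw [htr]; exact hs0), htr]
    congr 1
    · refine Finset.sum_congr rfl fun i _ => ?_
      simp only [hH]
      rw [Real.norm_of_nonneg (by positivity), ← Real.rpow_mul (norm_nonneg _),
        show p * s = (2 : ℕ) by rw [hs]; push_cast; field_simp, Real.rpow_natCast]
    · rw [hs]; field_simp
  simp_rw [hn] at key
  rw [PiLp.norm_eq_sum (by rw [htr]; exact hs0), htr] at key
  simp_rw [hcoord] at key
  have h0 : ∀ i, 0 ≤ ∫ x, ‖g i x‖ ^ p ∂AddCircle.haarAddCircle := fun i =>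
    integral_nonneg fun _ => by positivity
  simp_rw [fun i => Real.norm_of_nonneg (h0 i)] at key
  have hsum0 : 0 ≤ ∑ i, (∫ x, ‖g i x‖ ^ p ∂AddCircle.haarAddCircle) ^ s :=
    Finset.sum_nonneg fun i _ => Real.rpow_nonneg (h0 i) _
  have h2 := Real.rpow_le_rpow (Real.rpow_nonneg hsum0 _) key hs0.le
  rwa [← Real.rpow_mul hsum0, one_div_mul_cancel hs0.ne', Real.rpow_one] at h2

theorem continuous_integral_haarAddCircle {E : Type*} [NormedAddCommGroup E] [NormedSpace ℝ E]
    {X : Type*} [TopologicalSpace X] [FirstCountableTopology X]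
    [LocallyCompactSpace X] {Φ : X → UnitAddCircle → E}
    (hΦ : Continuous (Function.uncurry Φ)) :
    Continuous fun x => ∫ y, Φ x y ∂AddCircle.haarAddCircle := by
  have := continuous_parametric_integral_of_continuous
    (μ := (AddCircle.haarAddCircle : Measure UnitAddCircle)) hΦ isCompact_univ
  simpa using this

theorem continuous_fourierCoeff {X : Type*} [TopologicalSpace X] [FirstCountableTopology X]
    [LocallyCompactSpace X]
    {Φ : X → UnitAddCircle → ℂ} (hΦ : Continuous (Function.uncurry Φ)) (n : ℤ) :
    Continuous fun x => fourierCoeff (Φ x) n := by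
  refine continuous_integral_haarAddCircle (Φ := fun x y => fourier (-n) y • Φ x y) ?_
  exact ((fourier (-n)).continuous.comp continuous_snd).smul hΦ

theorem norm_fourierCoeff_le_of_forall_le {f : UnitAddCircle → ℂ} {M : ℝ}
    (hM : ∀ x, ‖f x‖ ≤ M) (n : ℤ) : ‖fourierCoeff f n‖ ≤ M := by
  have := norm_integral_le_of_norm_le_const
    (μ := (AddCircle.haarAddCircle : Measure UnitAddCircle))
    (f := fun x => fourier (-n) x • f x) (C := M) (Eventually.of_forall fun x => by
      rw [norm_smul, norm_fourier_apply, one_mul]; exact hM x)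
  rwa [probReal_univ, mul_one] at this

/-- The estimate in two variables for continuous functions of analytic type: the one-variable
estimate is applied in the first variable to each coefficient with respect to the second, and then,
after Minkowski's inequality, in the second variable. -/
theorem sum_sq_norm_iterated_fourierCoeff_le {p : ℝ} (hp1 : 1 < p) (hp : p ≤ 2)
    {Φ : UnitAddCircle → UnitAddCircle → ℂ} (hΦ : Continuous (Function.uncurry Φ))
    (h1 : ∀ x, ∃ b, IsAnalyticSeries (Φ x) b)
    (h2 : ∀ n : ℤ, ∃ a, IsAnalyticSeries (fun x => fourierCoeff (Φ x) n) a)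
    {S : Finset ℤ} (hS : ∀ m ∈ S, m ∈ meyerSet) :
    ∑ n ∈ S, ∑ m ∈ S, ‖fourierCoeff (fun x => fourierCoeff (Φ x) n) m‖ ^ 2
      ≤ (1053 / 2 * Real.exp 4 / (p - 1)) ^ 2 *
        (∫ x, ∫ y, ‖Φ x y‖ ^ p ∂AddCircle.haarAddCircle ∂AddCircle.haarAddCircle) ^ (2 / p) := by
  have hp0 : 0 < p := by linarith
  have hpm : 0 < p - 1 := by linarith
  set C := 1053 / 2 * Real.exp 4 / (p - 1) with hC
  have hC0 : 0 < C := by positivity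
  set g : ℤ → UnitAddCircle → ℂ := fun n x => fourierCoeff (Φ x) n with hg
  have hgc : ∀ n, Continuous (g n) := continuous_fourierCoeff hΦ
  set I : UnitAddCircle → ℝ := fun x => ∫ y, ‖Φ x y‖ ^ p ∂AddCircle.haarAddCircle with hI
  have hI0 : ∀ x, 0 ≤ I x := fun x => integral_nonneg fun _ => by positivity
  have hIc : Continuous I :=
    continuous_integral_haarAddCircle (Φ := fun x y => ‖Φ x y‖ ^ p)
      (hΦ.norm.rpow_const fun _ => Or.inr hp0.le)
  calc ∑ n ∈ S, ∑ m ∈ S, ‖fourierCoeff (g n) m‖ ^ 2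
      ≤ ∑ n ∈ S, C * (∫ x, ‖g n x‖ ^ p ∂AddCircle.haarAddCircle) ^ (2 / p) := by
        refine Finset.sum_le_sum fun n _ => ?_
        obtain ⟨a, ha⟩ := h2 n
        exact ha.sum_sq_norm_fourierCoeff_le hp1 hp hS
    _ = C * ∑ n : S, (∫ x, ‖g n x‖ ^ p ∂AddCircle.haarAddCircle) ^ (2 / p) := by
        rw [← Finset.mul_sum, ← Finset.sum_coe_sort S]
    _ ≤ C * (∫ x, (∑ n : S, ‖g n x‖ ^ 2) ^ (p / 2) ∂AddCircle.haarAddCircle) ^ (2 / p) := by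
        gcongr
        exact sum_integral_rpow_le hp0 hp (g := fun n : S => g n) fun n => hgc n
    _ ≤ C * (∫ x, C ^ (p / 2) * I x ∂AddCircle.haarAddCircle) ^ (2 / p) := by
        gcongr
        · refine (Continuous.rpow_const ?_ fun _ => Or.inr (by positivity)).integrable_haarAddCircle
          exact continuous_finsetSum _ fun n _ => (hgc n).norm.pow 2
        · exact (hIc.const_mul _).integrable_haarAddCircle
        · intro x
          obtain ⟨b, hb⟩ := h1 x
          have h3 := hb.sum_sq_norm_fourierCoeff_le hp1 hp hS
          rw [← Finset.sum_coe_sort S] at h3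
          calc _ ≤ (C * (I x) ^ (2 / p)) ^ (p / 2) :=
                Real.rpow_le_rpow (Finset.sum_nonneg fun _ _ => by positivity) h3 (by positivity)
            _ = C ^ (p / 2) * I x := by
                rw [Real.mul_rpow hC0.le (Real.rpow_nonneg (hI0 x) _), ← Real.rpow_mul (hI0 x),
                  show 2 / p * (p / 2) = 1 by field_simp, Real.rpow_one]
    _ = _ := by
        rw [integral_const_mul, Real.mul_rpow (by positivity) (integral_nonneg hI0),
          ← Real.rpow_mul hC0.le, show p / 2 * (2 / p) = 1 by field_simp, Real.rpow_one, sq,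
          mul_assoc]

/-- Fourier coefficients in the second variable of a family of analytic series in the first. -/
theorem IsAnalyticSeries.fourierCoeff_snd {Φ : UnitAddCircle → UnitAddCircle → ℂ}
    (hΦ : Continuous (Function.uncurry Φ)) {c : UnitAddCircle → ℕ → ℂ}
    (hc : ∀ y, IsAnalyticSeries (fun x => Φ x y) (c y)) {B : ℕ → ℝ} (hB : Summable B)
    (hcB : ∀ y m, ‖c y m‖ ≤ B m) (n : ℤ) :
    IsAnalyticSeries (fun x => fourierCoeff (Φ x) n) (fun m => fourierCoeff (fun y => c y m) n) := by
  have hcc : ∀ m, Continuous fun y => c y m := by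
    intro m
    have h1 := continuous_fourierCoeff (Φ := fun y x => Φ x y) (hΦ.comp continuous_swap) m
    refine h1.congr fun y => ?_
    exact (hc y).fourierCoeff_natCast m
  refine ⟨Summable.of_nonneg_of_le (fun _ => norm_nonneg _)
    (fun m => norm_fourierCoeff_le_of_forall_le (fun y => hcB y m) n) hB, fun x => ?_⟩
  have hi : ∀ m : ℕ, Integrable (fun y => fourier (-n) y • (c y m * fourier (m : ℤ) x))
      AddCircle.haarAddCircle := by
    intro m
    refine Continuous.integrable_haarAddCircle ?_
    exact (fourier (-n)).continuous.smul ((hcc m).mul continuous_const)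
  have hs : Summable fun m : ℕ => ∫ y, ‖fourier (-n) y • (c y m * fourier (m : ℤ) x)‖
      ∂AddCircle.haarAddCircle := by
    refine Summable.of_nonneg_of_le (fun m => integral_nonneg fun _ => norm_nonneg _)
      (fun m => ?_) hB
    have h1 := integral_mono (hi m).norm (integrable_const (B m)) fun y => by
      show ‖fourier (-n) y • (c y m * fourier (m : ℤ) x)‖ ≤ B m
      rw [norm_smul, norm_fourier_apply, one_mul, norm_mul, norm_fourier_apply, mul_one]
      exact hcB y m
    simpa using h1
  have key := hasSum_integral_of_summable_integral_norm hi hs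
  have e2 : ∫ y, ∑' m : ℕ, fourier (-n) y • (c y m * fourier (m : ℤ) x)
      ∂AddCircle.haarAddCircle = fourierCoeff (Φ x) n :=
    integral_congr_ae (Eventually.of_forall fun y =>
      (((hc y).2 x).const_smul (fourier (-n) y)).tsum_eq)
  rw [e2] at key
  refine key.congr_terms fun m => ?_
  change _ = (∫ y, fourier (-n) y • c y m ∂AddCircle.haarAddCircle) * _
  rw [← integral_mul_const]
  refine integral_congr_ae (Eventually.of_forall fun y => ?_)
  simp only [smul_eq_mul]
  ring

/-! ### Holomorphic functions on the bidisk -/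

instance (d : Type*) [Fintype d] : IsProbabilityMeasure (torusMeasure d) := by
  unfold torusMeasure; infer_instance

theorem integral_torusMeasure_fin_two {E : Type*} [NormedAddCommGroup E] [NormedSpace ℝ E]
    {f : UnitAddTorus (Fin 2) → E} (hf : Continuous f) :
    ∫ z, f z ∂torusMeasure (Fin 2)
      = ∫ x, ∫ y, f ![x, y] ∂AddCircle.haarAddCircle ∂AddCircle.haarAddCircle := by
  have hmp := (measurePreserving_finTwoArrow
    (AddCircle.haarAddCircle : Measure UnitAddCircle)).symm
  have h1 := hmp.integral_comp' (g := f)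
  have hc : Continuous fun w : UnitAddCircle × UnitAddCircle => f ![w.1, w.2] :=
    hf.comp (by fun_prop)
  have hi : Integrable (fun w : UnitAddCircle × UnitAddCircle => f ![w.1, w.2])
      ((AddCircle.haarAddCircle : Measure UnitAddCircle).prod AddCircle.haarAddCircle) :=
    hc.integrable_of_hasCompactSupport (HasCompactSupport.of_compactSpace _)
  rw [← integral_prod _ hi]
  exact h1.symm

theorem mFourierCoeff_fin_two {f : UnitAddTorus (Fin 2) → ℂ} (hf : Continuous f) (m n : ℤ) :
    UnitAddTorus.mFourierCoeff f ![m, n]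
      = fourierCoeff (fun x => fourierCoeff (fun y => f ![x, y]) n) m := by
  have h1 := integral_torusMeasure_fin_two
    (f := fun t => UnitAddTorus.mFourier (-![m, n]) t • f t)
    ((UnitAddTorus.mFourier (-![m, n])).continuous.smul hf)
  change ∫ t, UnitAddTorus.mFourier (-![m, n]) t • f t ∂torusMeasure (Fin 2) = _
  rw [h1]
  refine integral_congr_ae (Eventually.of_forall fun x => ?_)
  change _ = fourier (-m) x • ∫ y, fourier (-n) y • f ![x, y] ∂AddCircle.haarAddCircle
  rw [smul_eq_mul, ← integral_const_mul]
  refine integral_congr_ae (Eventually.of_forall fun y => ?_)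
  simp only [UnitAddTorus.mFourier, ContinuousMap.coe_mk, Fin.prod_univ_two, Pi.neg_apply,
    Matrix.cons_val_zero, Matrix.cons_val_one, smul_eq_mul]
  ring

theorem continuous_comp_polarPoint {d : Type*} [Fintype d] {F : (d → ℂ) → ℂ}
    (hF : DifferentiableOn ℂ F (polydisk d)) {r : d → ℝ} (hr : ∀ i, 0 ≤ r i ∧ r i < 1) :
    Continuous fun x => F (polarPoint r x) := by
  refine hF.continuousOn.comp_continuous ?_ fun x i => ?_
  · unfold polarPoint
    refine continuous_pi fun i => continuous_const.mul ?_
    exact continuous_subtype_val.comp (AddCircle.continuous_toCircle.comp (continuous_apply i))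
  · rw [polarPoint, norm_mul, Circle.norm_coe, mul_one, Complex.norm_real,
      Real.norm_of_nonneg (hr i).1]
    exact (hr i).2

theorem polarPoint_fin_two (r : Fin 2 → ℝ) (x y : UnitAddCircle) :
    polarPoint r ![x, y] = ![(r 0 : ℂ) * fourier 1 x, (r 1 : ℂ) * fourier 1 y] := by
  ext i
  fin_cases i <;> simp [polarPoint]

/-- The estimate on the torus of radius `r`. The coefficients in the first variable decay
geometrically, uniformly in the second variable, by comparison with a torus of larger first
radius. -/
theorem sum_sq_norm_mFourierCoeff_polarPoint_le {p : ℝ} (hp1 : 1 < p) (hp : p ≤ 2)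
    {F : (Fin 2 → ℂ) → ℂ} (hF : DifferentiableOn ℂ F (polydisk (Fin 2))) {r : ℝ} (hr0 : 0 ≤ r)
    (hr1 : r < 1) {S : Finset ℤ} (hS : ∀ m ∈ S, m ∈ meyerSet) :
    ∑ n ∈ S, ∑ m ∈ S,
        ‖UnitAddTorus.mFourierCoeff (fun x => F (polarPoint (fun _ => r) x)) ![m, n]‖ ^ 2
      ≤ (1053 / 2 * Real.exp 4 / (p - 1)) ^ 2 *
        (∫ x, ‖F (polarPoint (fun _ => r) x)‖ ^ p ∂torusMeasure (Fin 2)) ^ (2 / p) := by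
  have hp0 : 0 < p := by linarith
  have hfc := continuous_comp_polarPoint hF (r := fun _ => r) fun _ => ⟨hr0, hr1⟩
  simp_rw [mFourierCoeff_fin_two hfc]
  rw [integral_torusMeasure_fin_two (hfc.norm.rpow_const fun _ => Or.inr hp0.le)]
  obtain ⟨ρ, hrρ, hρ1⟩ := exists_between hr1
  have hρ0 : 0 < ρ := hr0.trans_lt hrρ
  have hcont : ∀ s : ℝ, 0 ≤ s → s < 1 → Continuous (Function.uncurry
      fun x y : UnitAddCircle => F (polarPoint ![s, r] ![x, y])) := by
    intro s hs0 hs1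
    have h1 := continuous_comp_polarPoint hF (r := ![s, r]) (by
      intro i; fin_cases i
      · exact ⟨hs0, hs1⟩
      · exact ⟨hr0, hr1⟩)
    exact h1.comp (by fun_prop : Continuous fun w : UnitAddCircle × UnitAddCircle => ![w.1, w.2])
  have hconst : (fun _ : Fin 2 => r) = ![r, r] := by ext i; fin_cases i <;> rfl
  have hΦ : Continuous (Function.uncurry
      fun x y : UnitAddCircle => F (polarPoint (fun _ => r) ![x, y])) := by
    rw [hconst]; exact hcont r hr0 hr1
  have hmem : ∀ z w : ℂ, ‖z‖ < 1 → ‖w‖ < 1 → ![z, w] ∈ polydisk (Fin 2) := by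
    intro z w hz hw i
    fin_cases i
    · exact hz
    · exact hw
  have hrn : ∀ x : UnitAddCircle, ‖(r : ℂ) * fourier 1 x‖ < 1 := by
    intro x
    rw [norm_mul, norm_fourier_apply, mul_one, Complex.norm_real, Real.norm_of_nonneg hr0]
    exact hr1
  refine sum_sq_norm_iterated_fourierCoeff_le hp1 hp
    (Φ := fun x y => F (polarPoint (fun _ => r) ![x, y])) hΦ (fun x => ?_) (fun n => ?_) hS
  · have hG : DifferentiableOn ℂ (fun w : ℂ => F ![r * fourier 1 x, w]) (Metric.ball 0 1) := by
      refine hF.comp ?_ fun w hw => hmem _ _ (hrn x) (mem_ball_zero_iff.mp hw)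
      refine Differentiable.differentiableOn (differentiable_pi.mpr fun i => ?_)
      fin_cases i
      · exact differentiable_const _
      · exact differentiable_id
    simp_rw [polarPoint_fin_two]
    exact ⟨_, IsAnalyticSeries.of_differentiableOn hG hr0 hr1⟩
  · have hG : ∀ y : UnitAddCircle,
        DifferentiableOn ℂ (fun w : ℂ => F ![w, r * fourier 1 y]) (Metric.ball 0 1) := by
      intro y
      refine hF.comp ?_ fun w hw => hmem _ _ (mem_ball_zero_iff.mp hw) (hrn y)
      refine Differentiable.differentiableOn (differentiable_pi.mpr fun i => ?_)
      fin_cases i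
      · exact differentiable_id
      · exact differentiable_const _
    obtain ⟨M, hM⟩ := isCompact_univ.exists_bound_of_continuousOn
      (hcont ρ hρ0.le hρ1).continuousOn
    set t : UnitAddCircle → ℕ → ℂ := fun y m =>
      (m.factorial : ℂ)⁻¹ * iteratedDeriv m (fun w : ℂ => F ![w, r * fourier 1 y]) 0 with ht
    have hser : ∀ s : ℝ, 0 ≤ s → s < 1 → ∀ y, IsAnalyticSeries
        (fun x => F (polarPoint ![s, r] ![x, y])) (fun m => t y m * s ^ m) := by
      intro s hs0 hs1 y
      simp_rw [polarPoint_fin_two]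
      exact IsAnalyticSeries.of_differentiableOn (hG y) hs0 hs1
    have hbound : ∀ y m, ‖t y m * r ^ m‖ ≤ M * (r / ρ) ^ m := by
      intro y m
      have h1 : ‖t y m * ρ ^ m‖ ≤ M := by
        rw [← (hser ρ hρ0.le hρ1 y).fourierCoeff_natCast m]
        exact norm_fourierCoeff_le_of_forall_le (fun x => hM (x, y) (Set.mem_univ _)) _
      have h2 : t y m * (r : ℂ) ^ m = (t y m * ρ ^ m) * ((r / ρ : ℝ) : ℂ) ^ m := by
        have : (ρ : ℂ) ≠ 0 := by exact_mod_cast hρ0.ne'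
        push_cast
        rw [div_pow]
        field_simp
      rw [h2, norm_mul, norm_pow, Complex.norm_real, Real.norm_of_nonneg (by positivity)]
      gcongr
    rw [hconst] at hΦ ⊢
    exact ⟨_, IsAnalyticSeries.fourierCoeff_snd hΦ (hser r hr0 hr1)
      ((summable_geometric_of_lt_one (by positivity) ((div_lt_one hρ0).mpr hrρ)).mul_left M)
      hbound n⟩

/-! ### Boundary values -/

/-- A family that is bounded in `Lᵖ` is uniformly integrable in `Lˢ` for `s < p`. -/
theorem unifIntegrable_of_eLpNorm_le {α ι : Type*} [MeasurableSpace α] {μ : Measure α}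
    [IsFiniteMeasure μ] {s p : ℝ} (hs : 0 < s) (hsp : s < p) {f : ι → α → ℂ}
    (hf : ∀ i, AEStronglyMeasurable (f i) μ) {M : ℝ≥0∞} (hM : M ≠ ∞)
    (hfM : ∀ i, eLpNorm (f i) (ENNReal.ofReal p) μ ≤ M) :
    UnifIntegrable f (ENNReal.ofReal s) μ := by
  intro ε hε
  have hp : 0 < p := hs.trans hsp
  set θ : ℝ := 1 / s - 1 / p with hθ
  have hθ0 : 0 < θ := sub_pos.mpr (one_div_lt_one_div_of_lt hs hsp)
  set B : ℝ := M.toReal + 1 with hB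
  have hB0 : 0 < B := by positivity
  refine ⟨(ε / B) ^ (1 / θ), by positivity, fun i E hE hμE => ?_⟩
  rw [eLpNorm_indicator_eq_eLpNorm_restrict hE]
  have h1 := eLpNorm_le_eLpNorm_mul_rpow_measure_univ (μ := μ.restrict E)
    (ENNReal.ofReal_le_ofReal hsp.le) (hf i).restrict
  rw [Measure.restrict_apply_univ, ENNReal.toReal_ofReal hs.le, ENNReal.toReal_ofReal hp.le] at h1
  calc _ ≤ _ := h1
    _ ≤ ENNReal.ofReal B * ENNReal.ofReal ((ε / B) ^ (1 / θ)) ^ θ := by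
        gcongr
        refine (eLpNorm_mono_measure _ Measure.restrict_le_self).trans ((hfM i).trans ?_)
        rw [← ENNReal.ofReal_toReal hM]
        exact ENNReal.ofReal_le_ofReal (by linarith)
    _ = ENNReal.ofReal ε := by
        rw [ENNReal.ofReal_rpow_of_nonneg (by positivity) hθ0.le,
          ← Real.rpow_mul (by positivity), one_div_mul_cancel hθ0.ne', Real.rpow_one,
          ← ENNReal.ofReal_mul hB0.le]
        congr 1
        field_simp

theorem tendsto_mFourierCoeff_of_tendsto_eLpNorm {d : Type*} [Fintype d] {s : ℝ} (hs : 1 ≤ s)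
    {f : ℕ → UnitAddTorus d → ℂ} {g : UnitAddTorus d → ℂ}
    (hf : ∀ i, MemLp (f i) (ENNReal.ofReal s) (torusMeasure d))
    (hg : MemLp g (ENNReal.ofReal s) (torusMeasure d))
    (h : Tendsto (fun i => eLpNorm (f i - g) (ENNReal.ofReal s) (torusMeasure d)) atTop (𝓝 0))
    (n : d → ℤ) :
    Tendsto (fun i => UnitAddTorus.mFourierCoeff (f i) n) atTop
      (𝓝 (UnitAddTorus.mFourierCoeff g n)) := by
  have hs' : 1 ≤ ENNReal.ofReal s := by rw [← ENNReal.ofReal_one]; gcongr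
  have hnorm : ∀ t : UnitAddTorus d, ‖UnitAddTorus.mFourier (-n) t‖ = 1 := by
    intro t
    simp only [UnitAddTorus.mFourier, ContinuousMap.coe_mk, norm_prod]
    exact Finset.prod_eq_one fun i _ => norm_fourier_apply _ _
  have hint : ∀ u : UnitAddTorus d → ℂ, MemLp u (ENNReal.ofReal s) (torusMeasure d) →
      Integrable (fun t => UnitAddTorus.mFourier (-n) t • u t) (torusMeasure d) := by
    intro u hu
    refine (hu.integrable hs').mono
      ((UnitAddTorus.mFourier (-n)).continuous.aestronglyMeasurable.smul hu.1)
      (Eventually.of_forall fun t => ?_)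
    rw [norm_smul, hnorm, one_mul]
  refine tendsto_integral_of_L1' (μ := torusMeasure d)
    (fun t => UnitAddTorus.mFourier (-n) t • g t) (hint g hg).1
    (Eventually.of_forall fun i => hint _ (hf i)) ?_
  refine tendsto_of_tendsto_of_tendsto_of_le_of_le tendsto_const_nhds h (fun _ => zero_le) ?_
  intro i
  calc _ = eLpNorm (f i - g) 1 (torusMeasure d) := by
        refine eLpNorm_congr_norm_ae (Eventually.of_forall fun t => ?_)
        rw [Pi.sub_apply, Pi.sub_apply, ← smul_sub, norm_smul, hnorm, one_mul]
    _ ≤ _ := eLpNorm_le_eLpNorm_of_exponent_le hs' ((hf i).sub hg).1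

theorem exists_seq_radii : ∃ ρ : ℕ → ℝ, (∀ k, 0 ≤ ρ k ∧ ρ k < 1) ∧ Tendsto ρ atTop (𝓝[<] 1) := by
  obtain ⟨ρ, -, hρ, hlim⟩ := exists_seq_strictMono_tendsto' (zero_lt_one (α := ℝ))
  exact ⟨ρ, fun k => ⟨(hρ k).1.le, (hρ k).2⟩,
    tendsto_nhdsWithin_iff.mpr ⟨hlim, Eventually.of_forall fun k => (hρ k).2⟩⟩

theorem hardySpace.aestronglyMeasurable {d : Type*} [Fintype d] {p : ℝ}
    {f : UnitAddTorus d → ℂ} (hf : f ∈ hardySpace d p) :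
    AEStronglyMeasurable f (torusMeasure d) := by
  obtain ⟨F, hF, -, hlim⟩ := hf
  obtain ⟨ρ, hρ01, hρlim⟩ := exists_seq_radii
  refine aestronglyMeasurable_of_tendsto_ae atTop (f := fun k x => F (polarPoint (fun _ => ρ k) x))
    (fun k => (continuous_comp_polarPoint hF fun _ => hρ01 k).aestronglyMeasurable) ?_
  filter_upwards [hlim] with x hx
  exact hx.comp hρlim

/-- The estimate for a finite part of the sum and an exponent `s < p`. In `Lˢ` the functions on the
tori of radius `r < 1` converge to their boundary values in norm. -/
theorem hardySpace.ofReal_sqrt_sum_le {s p : ℝ} (hs : 1 < s) (hsp : s < p) (hp : p ≤ 2)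
    {f : UnitAddTorus (Fin 2) → ℂ} (hf : f ∈ hardySpace (Fin 2) p) {S : Finset ℤ}
    (hS : ∀ m ∈ S, m ∈ meyerSet) :
    ENNReal.ofReal √(∑ n ∈ S, ∑ m ∈ S, ‖UnitAddTorus.mFourierCoeff f ![m, n]‖ ^ 2)
      ≤ ENNReal.ofReal (1053 / 2 * Real.exp 4 / (s - 1))
        * eLpNorm f (ENNReal.ofReal s) (torusMeasure (Fin 2)) := by
  have hfm := hardySpace.aestronglyMeasurable hf
  obtain ⟨F, hF, hbdd, hlim⟩ := hf
  have hs0 : 0 < s := by linarith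
  have hp0 : 0 < p := by linarith
  have hsm : 0 < s - 1 := by linarith
  have hs1' : 1 ≤ ENNReal.ofReal s := by rw [← ENNReal.ofReal_one]; gcongr
  set C := 1053 / 2 * Real.exp 4 / (s - 1) with hC
  have hC0 : 0 < C := by positivity
  set M := ⨆ r ∈ {r : Fin 2 → ℝ | ∀ i, 0 ≤ r i ∧ r i < 1},
      ∫⁻ x, ‖F (polarPoint r x)‖ₑ ^ p ∂(torusMeasure (Fin 2)) with hM
  obtain ⟨ρ, hρ01, hρlim⟩ := exists_seq_radii
  set u : ℕ → UnitAddTorus (Fin 2) → ℂ := fun k x => F (polarPoint (fun _ => ρ k) x) with hu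
  have huc : ∀ k, Continuous (u k) := fun k =>
    continuous_comp_polarPoint hF fun _ => hρ01 k
  have huM : ∀ k, eLpNorm (u k) (ENNReal.ofReal p) (torusMeasure (Fin 2)) ≤ M ^ (1 / p) := by
    intro k
    rw [eLpNorm_eq_lintegral_rpow_enorm_toReal (by simpa using hp0) ENNReal.ofReal_ne_top,
      ENNReal.toReal_ofReal hp0.le]
    refine ENNReal.rpow_le_rpow ?_ (by positivity)
    exact le_biSup (fun r : Fin 2 → ℝ =>
      ∫⁻ x, ‖F (polarPoint r x)‖ₑ ^ p ∂(torusMeasure (Fin 2)))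
      (show (fun _ => ρ k) ∈ {r : Fin 2 → ℝ | ∀ i, 0 ≤ r i ∧ r i < 1} from
        fun _ => hρ01 k)
  have hMtop : M ^ (1 / p) ≠ ∞ := ENNReal.rpow_ne_top_of_nonneg (by positivity) hbdd.ne
  have hae : ∀ᵐ x ∂(torusMeasure (Fin 2)), Tendsto (fun k => u k x) atTop (𝓝 (f x)) := by
    filter_upwards [hlim] with x hx
    exact hx.comp hρlim
  have hum : ∀ k, AEStronglyMeasurable (u k) (torusMeasure (Fin 2)) := fun k =>
    (huc k).aestronglyMeasurable
  have hfp : MemLp f (ENNReal.ofReal p) (torusMeasure (Fin 2)) := by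
    refine ⟨hfm, lt_of_le_of_lt ?_ hMtop.lt_top⟩
    refine (Lp.eLpNorm_lim_le_liminf_eLpNorm hum f hae).trans ?_
    refine (liminf_le_liminf (Eventually.of_forall huM)).trans ?_
    simp
  have hfs : MemLp f (ENNReal.ofReal s) (torusMeasure (Fin 2)) :=
    hfp.mono_exponent (ENNReal.ofReal_le_ofReal hsp.le)
  have hus : ∀ k, MemLp (u k) (ENNReal.ofReal s) (torusMeasure (Fin 2)) := fun k =>
    (huc k).memLp_of_hasCompactSupport (HasCompactSupport.of_compactSpace _)
  have hconv := tendsto_Lp_finite_of_tendsto_ae hs1' ENNReal.ofReal_ne_top hum hfs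
    (unifIntegrable_of_eLpNorm_le hs0 hsp hum hMtop huM) hae
  have hest : ∀ k, ENNReal.ofReal √(∑ n ∈ S, ∑ m ∈ S,
        ‖UnitAddTorus.mFourierCoeff (u k) ![m, n]‖ ^ 2)
      ≤ ENNReal.ofReal C * (eLpNorm (u k - f) (ENNReal.ofReal s) (torusMeasure (Fin 2))
        + eLpNorm f (ENNReal.ofReal s) (torusMeasure (Fin 2))) := by
    intro k
    have h1 := sum_sq_norm_mFourierCoeff_polarPoint_le hs (hsp.le.trans hp) hF (hρ01 k).1 (hρ01 k).2 hS
    set I := ∫ x, ‖F (polarPoint (fun _ => ρ k) x)‖ ^ s ∂torusMeasure (Fin 2) with hI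
    have hI0 : 0 ≤ I := integral_nonneg fun _ => by positivity
    have h2 : √(∑ n ∈ S, ∑ m ∈ S, ‖UnitAddTorus.mFourierCoeff (u k) ![m, n]‖ ^ 2)
        ≤ C * I ^ (1 / s) := by
      rw [Real.sqrt_le_left (by positivity)]
      refine h1.trans (le_of_eq ?_)
      rw [mul_pow, ← Real.rpow_natCast (I ^ (1 / s)), ← Real.rpow_mul hI0]
      congr 2
      push_cast
      ring
    have h3 : eLpNorm (u k) (ENNReal.ofReal s) (torusMeasure (Fin 2))
        = ENNReal.ofReal (I ^ (1 / s)) := by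
      rw [(hus k).eLpNorm_eq_integral_rpow_norm (by simpa using hs0) ENNReal.ofReal_ne_top,
        ENNReal.toReal_ofReal hs0.le, one_div]
    calc _ ≤ ENNReal.ofReal (C * I ^ (1 / s)) := ENNReal.ofReal_le_ofReal h2
      _ = ENNReal.ofReal C * eLpNorm (u k) (ENNReal.ofReal s) (torusMeasure (Fin 2)) := by
          rw [h3, ENNReal.ofReal_mul hC0.le]
      _ ≤ _ := by
          gcongr
          have := eLpNorm_add_le ((hus k).sub hfs).1 hfm hs1'
          rwa [sub_add_cancel] at this
  have hL : Tendsto (fun k => ENNReal.ofReal √(∑ n ∈ S, ∑ m ∈ S,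
        ‖UnitAddTorus.mFourierCoeff (u k) ![m, n]‖ ^ 2)) atTop
      (𝓝 (ENNReal.ofReal √(∑ n ∈ S, ∑ m ∈ S, ‖UnitAddTorus.mFourierCoeff f ![m, n]‖ ^ 2))) := by
    refine ENNReal.tendsto_ofReal (Tendsto.sqrt ?_)
    refine tendsto_finsetSum _ fun n _ => tendsto_finsetSum _ fun m _ => ?_
    exact (tendsto_mFourierCoeff_of_tendsto_eLpNorm hs.le hus hfs hconv _).norm.pow 2
  have hR := ENNReal.Tendsto.const_mul (a := ENNReal.ofReal C) (hconv.add_const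
    (eLpNorm f (ENNReal.ofReal s) (torusMeasure (Fin 2)))) (Or.inr ENNReal.ofReal_ne_top)
  rw [zero_add] at hR
  exact le_of_tendsto_of_tendsto' hL hR hest

theorem proposition4p3 :
    ∃ A₀ : ℝ, 0 < A₀ ∧
      ∀ p : ℝ, 1 < p → p ≤ 2 → ∀ f ∈ hardySpace (Fin 2) p,
        (∑' q : ↥(meyerSet ×ˢ meyerSet),
            ‖UnitAddTorus.mFourierCoeff f ![q.1.1, q.1.2]‖ₑ ^ 2) ^ (1 / 2 : ℝ)
          ≤ ENNReal.ofReal (A₀ / (p - 1)) * eLpNorm f (ENNReal.ofReal p) (torusMeasure (Fin 2)) := by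
  refine ⟨1053 / 2 * Real.exp 4, by positivity, fun p hp1 hp f hf => ?_⟩
  set A := 1053 / 2 * Real.exp 4 with hA
  have hA0 : 0 < A := by positivity
  set B := ENNReal.ofReal (A / (p - 1)) * eLpNorm f (ENNReal.ofReal p) (torusMeasure (Fin 2))
    with hB
  have hfm := hardySpace.aestronglyMeasurable hf
  have hfin : ∀ S : Finset ℤ, (∀ m ∈ S, m ∈ meyerSet) →
      ENNReal.ofReal √(∑ n ∈ S, ∑ m ∈ S, ‖UnitAddTorus.mFourierCoeff f ![m, n]‖ ^ 2) ≤ B := by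
    intro S hS
    have hlim : Tendsto (fun s : ℝ => ENNReal.ofReal (A / (s - 1))
        * eLpNorm f (ENNReal.ofReal p) (torusMeasure (Fin 2))) (𝓝[<] p) (𝓝 B) := by
      have hpm : 0 < p - 1 := by linarith
      refine ENNReal.Tendsto.mul_const (ENNReal.tendsto_ofReal ?_)
        (Or.inl (by simpa using div_pos hA0 hpm))
      refine Tendsto.mono_left ?_ nhdsWithin_le_nhds
      exact tendsto_const_nhds.div (tendsto_id.sub tendsto_const_nhds) hpm.ne'
    refine ge_of_tendsto hlim ?_
    filter_upwards [Ioo_mem_nhdsLT hp1] with s hs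
    refine (hardySpace.ofReal_sqrt_sum_le hs.1 hs.2 hp hf hS).trans ?_
    gcongr
    exact eLpNorm_le_eLpNorm_of_exponent_le (ENNReal.ofReal_le_ofReal hs.2.le) hfm
  have hsq : ∑' q : ↥(meyerSet ×ˢ meyerSet),
      ‖UnitAddTorus.mFourierCoeff f ![q.1.1, q.1.2]‖ₑ ^ 2 ≤ B ^ 2 := by
    rw [ENNReal.tsum_eq_iSup_sum]
    refine iSup_le fun T => ?_
    set S : Finset ℤ := T.image (fun q => q.1.1) ∪ T.image (fun q => q.1.2) with hSdef
    have hS : ∀ m ∈ S, m ∈ meyerSet := by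
      intro m hm
      rcases Finset.mem_union.mp hm with h | h
      · obtain ⟨q, -, rfl⟩ := Finset.mem_image.mp h
        exact q.2.1
      · obtain ⟨q, -, rfl⟩ := Finset.mem_image.mp h
        exact q.2.2
    set c : ℤ × ℤ → ℝ := fun q => ‖UnitAddTorus.mFourierCoeff f ![q.1, q.2]‖ ^ 2 with hc
    have h1 : ∑ q ∈ T, c q.1 ≤ ∑ n ∈ S, ∑ m ∈ S, c (m, n) := by
      rw [Finset.sum_comm, ← Finset.sum_product',
        ← Finset.sum_image (g := fun q : ↥(meyerSet ×ˢ meyerSet) => q.1) (f := c)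
          Subtype.val_injective.injOn]
      refine Finset.sum_le_sum_of_subset_of_nonneg ?_ fun _ _ _ => by positivity
      intro y hy
      obtain ⟨q, hq, rfl⟩ := Finset.mem_image.mp hy
      exact Finset.mem_product.mpr
        ⟨Finset.mem_union_left _ (Finset.mem_image_of_mem _ hq),
          Finset.mem_union_right _ (Finset.mem_image_of_mem _ hq)⟩
    have h2 : ∑ q ∈ T, ‖UnitAddTorus.mFourierCoeff f ![q.1.1, q.1.2]‖ₑ ^ 2
        = ENNReal.ofReal (∑ q ∈ T, c q.1) := by
      rw [ENNReal.ofReal_sum_of_nonneg fun _ _ => by positivity]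
      refine Finset.sum_congr rfl fun q _ => ?_
      rw [hc, ENNReal.ofReal_pow (norm_nonneg _), ofReal_norm]
    rw [h2]
    calc _ ≤ ENNReal.ofReal (∑ n ∈ S, ∑ m ∈ S, c (m, n)) := ENNReal.ofReal_le_ofReal h1
      _ = ENNReal.ofReal √(∑ n ∈ S, ∑ m ∈ S, c (m, n)) ^ 2 := by
          rw [← ENNReal.ofReal_pow (Real.sqrt_nonneg _), Real.sq_sqrt
            (Finset.sum_nonneg fun _ _ => Finset.sum_nonneg fun _ _ => by positivity)]
      _ ≤ B ^ 2 := by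
          gcongr
          exact hfin S hS
  calc _ ≤ (B ^ 2) ^ (1 / 2 : ℝ) := ENNReal.rpow_le_rpow hsq (by norm_num)
    _ = B := by
        rw [← ENNReal.rpow_natCast, ← ENNReal.rpow_mul]
        norm_num
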